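/- Let $q\ge 5$ be a prime power, let $x$ be a primitive element of the finite field $\mathbb F_q$ (a generator of $\mathbb F_q^\times$), and let $\sigma_1,\sigma_2,\sigma_3\in\mathrm{PSL}(3,q)$ be the classes of the matrices of determinant $1$ \[ \begin{pmatrix} x & 1 & 0\\ 0 & 1+x^{-1} & -x^{-1}\\ 0 & 1 & 0\end{pmatrix},\qquad \begin{pmatrix} -x^{-1} & 0 & 0\\ 0 & 0 & 1\\ 0 & x & 0\end{pmatrix},\qquad \begin{pmatrix} x & 0 & 0\\ x-x^{-1} & 1 & 0\\ x-x^{-1} & 0 & x^{-1}\end{pmatrix}, \] acting on column vectors, and hence on the points and lines of the projective plane $\mathrm{PG}(2,q)$. Write $\tau_{i,j}=\sigma_{i+1}\sigma_{i+2}\cdots\sigma_j$ for $0\le i<j\le 3$. Then the following hold. 1. The pair $(\mathrm{PSL}(3,q),(\sigma_1,\sigma_2,\sigma_3))$ is a $C^+$-group of rank four, i.e. the automorphism group of a chiral polytope of rank four together with its distinguished generators. This means: - (generation) $\langle\sigma_1,\sigma_2,\sigma_3\rangle=\mathrm{PSL}(3,q)$; - (string property) $\sigma_1\sigma_2$, $\sigma_2\sigma_3$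 and $\sigma_1\sigma_2\sigma_3$ are involutions (elements of order exactly $2$); - (intersection property) for all $I,J\subseteq\{0,1,2,3\}$, \[\langle \tau_{i,j} : i<j,\ i,j\notin I\rangle\cap\langle \tau_{i,j}: i<j,\ i,j\notin J\rangle=\langle \tau_{i,j}: i<j,\ i,j\notin I\cup J\rangle;\] - (chirality) no automorphism of the group $\mathrm{PSL}(3,q)$ sends $\sigma_1$ to $\sigma_1^{-1}$ and fixes both $\sigma_1\sigma_2$ and $\sigma_1\sigma_2\sigma_3$. 2. There are two distinct lines $l,l'$ of $\mathrm{PG}(2,q)$ such that $\langle\sigma_1,\sigma_2\rangle$ is the (setwise) stabiliser of $\{l,l'\}$ in $\mathrm{PSL}(3,q)$, and there are two distinct points $p,p'$ such that $\langle\sigma_2,\sigma_3\rangle$ is the (setwise) stabiliser of $\{p,p'\}$ in $\mathrm{PSL}(3,q)$. 3. The $C^+$-group is self-dual, i.e. isomorphic to its dual: there is an automorphism $\varphi$ of $\mathrm{PSL}(3,q)$ with $\varphi(\sigma_1)=\sigma_3^{-1}$, $\varphi(\sigma_2)=\sigma_2^{-1}$, $\varphi(\sigma_3)=\sigma_1^{-1}$.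 4. Its Schläfli type, i.e. the triple of the orders of $\sigma_1,\sigma_2,\sigma_3$ in $\mathrm{PSL}(3,q)$, is $\left\{q-1,\ \frac{2(q-1)}{\gcd(3,q-1)},\ q-1\right\}$. -/

import Mathlib

open scoped MatrixGroups Pointwise

section CPlusGroups

variable {G : Type*} [Group G]

/-- For a tuple `σ = (σ₁, …, σₙ)`, stored as `σ 0, …, σ (n - 1)`, this is the product
`σ_{i+1} σ_{i+2} ⋯ σ_j`, for `0 ≤ i ≤ j ≤ n` (it is `1` if `i = j`). When `σ_k = ρ_{k-1} ρ_k`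
for involutions `ρ₀, …, ρₙ`, it is the product `ρ_i ρ_j`. -/
def rotProd {n : ℕ} (σ : Fin n → G) (i j : Fin (n + 1)) : G :=
  (((List.ofFn σ).take j).drop i).prod

/-- The subgroup generated by the products `σ_{i+1} ⋯ σ_j` with `i < j` and `i, j ∉ I`, where
`I ⊆ {0, …, n}` is a set of ranks. It is the stabiliser, in the rotation group of a polytope of
rank `n + 1`, of the faces of the base flag with rank in `I`. -/
def rotSubgroup {n : ℕ} (σ : Fin n → G) (I : Set (Fin (n + 1))) : Subgroup G :=
  Subgroup.closure {g | ∃ i j : Fin (n + 1), i < j ∧ i ∉ I ∧ j ∉ I ∧ g = rotProd σ i j}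

/-- `(G, (σ₁, …, σ_{r-1}))` is a `C⁺`-group of rank `r = m + 2`: the automorphism group of a chiral
polytope of rank `r` with its distinguished generators. -/
structure IsCPlusGroup {m : ℕ} (σ : Fin (m + 1) → G) : Prop where
  /-- The `σ_i` generate `G`. -/
  generates : Subgroup.closure (Set.range σ) = ⊤
  /-- String property: the product of at least two consecutive `σ_i` is an involution. -/
  string : ∀ i j : Fin (m + 2), (i : ℕ) + 1 < j → orderOf (rotProd σ i j) = 2
  /-- Intersection property `IP⁺`. -/
  intersection : ∀ I J : Set (Fin (m + 2)),
    rotSubgroup σ I ⊓ rotSubgroup σ J = rotSubgroup σ (I ∪ J)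
  /-- Chirality: no automorphism of `G` inverts `σ₁` and fixes every `σ₁ ⋯ σ_j` with `j ≥ 2`. -/
  chiral : ¬ ∃ φ : G ≃* G, φ (σ 0) = (σ 0)⁻¹ ∧
    ∀ j : Fin (m + 2), 2 ≤ (j : ℕ) → φ (rotProd σ 0 j) = rotProd σ 0 j

/-- The Schläfli type: the tuple of orders of the `σ_i`. -/
noncomputable def schlafliType {n : ℕ} (σ : Fin n → G) : Fin n → ℕ := fun i => orderOf (σ i)

/-- The dual tuple `(σₙ⁻¹, …, σ₁⁻¹)`. -/
def dualTuple {n : ℕ} (σ : Fin n → G) : Fin n → G := fun i => (σ i.rev)⁻¹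

/-- `(G, σ)` is isomorphic to its dual. -/
def IsSelfDual {n : ℕ} (σ : Fin n → G) : Prop :=
  ∃ φ : G ≃* G, ∀ i, φ (σ i) = dualTuple σ i

end CPlusGroups

section ProjectivePlane

variable {F : Type*} [Field F] {n : ℕ}

/-- Scalar matrices fix every subspace. -/
theorem center_smul_submodule (A : Matrix.SpecialLinearGroup (Fin n) F)
    (hA : A ∈ Subgroup.center (Matrix.SpecialLinearGroup (Fin n) F))
    (W : Submodule F (Fin n → F)) : A • W = W := by
  obtain ⟨r, hr, hs⟩ := Matrix.SpecialLinearGroup.mem_center_iff.1 hA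
  have key : ∀ v : Fin n → F, A • v = r • v := by
    intro v
    rw [Matrix.SpecialLinearGroup.smul_def, ← hs]
    simp
  by_cases h0 : n = 0
  · subst h0
    exact Subsingleton.elim _ _
  have hr0 : r ≠ 0 := by
    rintro rfl
    simp [h0] at hr
  ext v
  rw [Submodule.mem_smul_pointwise_iff_exists]
  constructor
  · rintro ⟨w, hw, rfl⟩
    rw [key]
    exact W.smul_mem r hw
  · intro hv
    refine ⟨r⁻¹ • v, W.smul_mem _ hv, ?_⟩
    rw [key, smul_smul, mul_inv_cancel₀ hr0, one_smul]

/-- The action of `PSL(n, F)` on the subspaces of `Fⁿ`, as a homomorphism. -/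
def pslPermHom (n : ℕ) (F : Type*) [Field F] :
    PSL(n, F) →* Equiv.Perm (Submodule F (Fin n → F)) :=
  QuotientGroup.lift _
    (MulAction.toPermHom (Matrix.SpecialLinearGroup (Fin n) F) (Submodule F (Fin n → F)))
    (fun A hA => Equiv.ext fun W => center_smul_submodule A hA W)

/-- The natural action of `PSL(n, F)` on the subspaces of `Fⁿ` (column vectors): the class of the
matrix `A` sends `W` to `A W`. For `n = 3` the subspaces of dimensions 1 and 2 are the points and
the lines of the projective plane `PG(2, F)`. -/
instance pslMulAction : MulAction PSL(n, F) (Submodule F (Fin n → F)) :=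
  MulAction.compHom _ (pslPermHom n F)

theorem psl_smul_coe (A : Matrix.SpecialLinearGroup (Fin n) F) (W : Submodule F (Fin n → F)) :
    (A : PSL(n, F)) • W = W.map (Matrix.toLin' (A : Matrix (Fin n) (Fin n) F)) := rfl

end ProjectivePlane

section Generators

variable {F : Type*} [Field F]

def sigmaMat1 (x : Fˣ) : SL(3, F) :=
  ⟨!![(x : F), 1, 0;
      0, 1 + (x : F)⁻¹, -(x : F)⁻¹;
      0, 1, 0], by simp [Matrix.det_fin_three]⟩

def sigmaMat2 (x : Fˣ) : SL(3, F) :=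
  ⟨!![-(x : F)⁻¹, 0, 0;
      0, 0, 1;
      0, (x : F), 0], by simp [Matrix.det_fin_three]⟩

def sigmaMat3 (x : Fˣ) : SL(3, F) :=
  ⟨!![(x : F), 0, 0;
      (x : F) - (x : F)⁻¹, 1, 0;
      (x : F) - (x : F)⁻¹, 0, (x : F)⁻¹], by simp [Matrix.det_fin_three]⟩

/-- The triple `(σ₁, σ₂, σ₃)` of elements of `PSL(3, F)`. -/
def sigma (x : Fˣ) : Fin 3 → PSL(3, F) :=
  ![(sigmaMat1 x : PSL(3, F)), (sigmaMat2 x : PSL(3, F)), (sigmaMat3 x : PSL(3, F))]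

end Generators

/-! Everything is read off from the stabiliser of a pair of points. The matrices of σ₂ and σ₃
preserve the pair spanned by the last two basis vectors: σ₃ fixes both points and σ₂ swaps them. The
elations whose axis joins the two points form a copy of F², which σ₃ and σ₂² normalise by scaling
the coordinates by (x⁻¹, x⁻²) and (x³, x³). A commutator word in σ₂ and σ₃ is an elation (a, 0),
with a ≠ 0 because x² ≠ 1 and x³ ≠ 1; this is where q ≥ 5 enters. Conjugating by powers of σ₃ and by
σ₂ then gives all elations, next all diagonal matrices, and so the full stabiliser
(`mem_closure_of_permutesPoints`, `closure_sigma_points`).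

A polarity of the plane sends σ₁, σ₂, σ₃ to σ₃⁻¹, σ₂⁻¹, σ₁⁻¹. It gives self-duality, and carries
every fact about ⟨σ₂, σ₃⟩ to ⟨σ₁, σ₂⟩, the stabiliser of the two polar lines
(`closure_sigma_lines`). The two stabilisers together contain all transvections and diagonal
matrices, whence generation.

For chirality, an automorphism as excluded would, after a conjugation, invert σ₂ and σ₃. It would
then send the elation (ya, 0) to (y⁻¹b, 0) for every nonzero y; additivity at 1 + x gives x² + x + 1
= 0, against x³ ≠ 1 (`not_exists_invert`).

The intersection property reduces to a few conditions on ⟨σ₁, σ₂⟩, ⟨σ₂, σ₃⟩ and two dihedral groups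
(`intersection_rank_four`), checked on matrix entries. The main one is that an element preserving
both the point pair and the line pair is a power of σ₂. -/

open scoped commutatorElement

/-! ### Intersection property: reduction for arbitrary rank, and cyclic and dihedral subgroups. -/

section RotationSubgroups

variable {G : Type*} [Group G] {n : ℕ}

theorem rotSubgroup_anti (σ : Fin n → G) {I J : Set (Fin (n + 1))} (h : I ⊆ J) :
    rotSubgroup σ J ≤ rotSubgroup σ I :=
  Subgroup.closure_mono fun _ ⟨i, j, hij, hi, hj, hg⟩ =>
    ⟨i, j, hij, fun hi' => hi (h hi'), fun hj' => hj (h hj'), hg⟩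

/-- The intersection property follows from its instances for two sets of ranks whose complements
each miss exactly one element of their union. -/
theorem rotSubgroup_inf_of_erase (σ : Fin n → G)
    (h : ∀ (S : Finset (Fin (n + 1))) (a b : Fin (n + 1)), a ∈ S → b ∈ S → a ≠ b →
      rotSubgroup σ (↑(S.erase a))ᶜ ⊓ rotSubgroup σ (↑(S.erase b))ᶜ ≤
        rotSubgroup σ (↑((S.erase a).erase b))ᶜ)
    (I J : Set (Fin (n + 1))) :
    rotSubgroup σ I ⊓ rotSubgroup σ J = rotSubgroup σ (I ∪ J) := by
  classical
  have key : ∀ m (S T : Finset (Fin (n + 1))), (S ∪ T).card = m →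
      rotSubgroup σ (↑S)ᶜ ⊓ rotSubgroup σ (↑T)ᶜ ≤ rotSubgroup σ (↑(S ∩ T))ᶜ := by
    intro m
    induction m using Nat.strong_induction_on with
    | _ m ih =>
      intro S T hm
      by_cases hTS : T ⊆ S
      · rw [Finset.inter_eq_right.2 hTS]
        exact inf_le_right
      by_cases hST : S ⊆ T
      · rw [Finset.inter_eq_left.2 hST]
        exact inf_le_left
      obtain ⟨a, haT, haS⟩ := Finset.not_subset.1 hTS
      obtain ⟨b, hbS, hbT⟩ := Finset.not_subset.1 hST
      have hab : a ≠ b := by rintro rfl; exact haS hbS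
      have mono : ∀ {U V : Finset (Fin (n + 1))}, U ⊆ V →
          rotSubgroup σ (↑U)ᶜ ≤ rotSubgroup σ (↑V)ᶜ := fun {U V} hUV =>
        rotSubgroup_anti σ (Set.compl_subset_compl.2 (Finset.coe_subset.2 hUV))
      -- The induction hypothesis applies as soon as U and V both miss some z of `S ∪ T`, since
      -- their union is then smaller.
      have step : ∀ (U V : Finset (Fin (n + 1))) (z : Fin (n + 1)), z ∈ S ∪ T → z ∉ U → z ∉ V →
          U ⊆ S ∪ T → V ⊆ S ∪ T → rotSubgroup σ (↑U)ᶜ ⊓ rotSubgroup σ (↑V)ᶜ ≤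
            rotSubgroup σ (↑(U ∩ V))ᶜ := by
        intro U V z hz hzU hzV hU hV
        refine ih _ ?_ U V rfl
        rw [← hm]
        refine Finset.card_lt_card ((Finset.ssubset_iff_of_subset (Finset.union_subset hU hV)).2
          ⟨z, hz, ?_⟩)
        simp [hzU, hzV]
      set W := ((S ∪ T).erase a).erase b with hW
      have haW : a ∉ W := by simp [hW]
      have hbW : b ∉ W := by simp [hW]
      have hWR : W ⊆ S ∪ T := (Finset.erase_subset _ _).trans (Finset.erase_subset _ _)
      have ha : a ∈ S ∪ T := Finset.mem_union_right _ haT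
      have hb : b ∈ S ∪ T := Finset.mem_union_left _ hbS
      -- The hypothesis `h` on `S ∪ T` first puts g in the group of W. The pair S, W misses a, the
      -- pair T, W misses b, and the two resulting intersections both miss a, so `step` applies
      -- three times.
      intro g hg
      have hgR : g ∈ rotSubgroup σ (↑W)ᶜ := h (S ∪ T) a b ha hb hab
        ⟨mono (Finset.subset_erase.2 ⟨Finset.subset_union_left, haS⟩) hg.1,
          mono (Finset.subset_erase.2 ⟨Finset.subset_union_right, hbT⟩) hg.2⟩
      have hS := step S W a ha haS haW Finset.subset_union_left hWR ⟨hg.1, hgR⟩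
      have hT := step T W b hb hbT hbW Finset.subset_union_right hWR ⟨hg.2, hgR⟩
      refine mono ?_ (step (S ∩ W) (T ∩ W) a ha (by simp [haW]) (by simp [haW])
        (Finset.inter_subset_right.trans hWR) (Finset.inter_subset_right.trans hWR) ⟨hS, hT⟩)
      exact Finset.inter_subset_inter Finset.inter_subset_left Finset.inter_subset_left
  refine le_antisymm ?_ (le_inf (rotSubgroup_anti σ Set.subset_union_left)
    (rotSubgroup_anti σ Set.subset_union_right))
  have := key _ (Set.toFinset Iᶜ) (Set.toFinset Jᶜ) rfl
  simpa [Set.compl_inter] using this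

/-- Elements of a dihedral group. -/
theorem mem_closure_dihedral {a u g : G} (hu : u * u = 1) (hau : u * a * u = a⁻¹)
    (hg : g ∈ Subgroup.closure {a, u}) : ∃ k : ℤ, g = a ^ k ∨ g = a ^ k * u := by
  have hui : u⁻¹ = u := inv_eq_of_mul_eq_one_left hu
  have key : ∀ k : ℤ, u * a ^ k = a ^ (-k) * u := by
    intro k
    have h1 : (u * a * u⁻¹) ^ k = u * a ^ k * u⁻¹ := conj_zpow
    rw [hui, hau] at h1
    rw [zpow_neg, ← inv_zpow, h1, mul_assoc, hu, mul_one]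
  induction hg using Subgroup.closure_induction with
  | mem g hg =>
    rcases hg with rfl | rfl
    · exact ⟨1, Or.inl (zpow_one _).symm⟩
    · exact ⟨0, Or.inr (by simp)⟩
  | one => exact ⟨0, Or.inl (by simp)⟩
  | mul g h _ _ hg hh =>
    obtain ⟨k, rfl | rfl⟩ := hg <;> obtain ⟨l, rfl | rfl⟩ := hh
    · exact ⟨k + l, Or.inl (zpow_add _ _ _).symm⟩
    · exact ⟨k + l, Or.inr (by rw [zpow_add, mul_assoc])⟩
    · exact ⟨k - l, Or.inr (by rw [mul_assoc, key, ← mul_assoc, sub_eq_add_neg, zpow_add])⟩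
    · refine ⟨k - l, Or.inl ?_⟩
      rw [mul_assoc, ← mul_assoc u, key, mul_assoc, hu, mul_one, sub_eq_add_neg, zpow_add]
  | inv g _ hg =>
    obtain ⟨k, rfl | rfl⟩ := hg
    · exact ⟨-k, Or.inl (zpow_neg _ _).symm⟩
    · exact ⟨k, Or.inr (by rw [mul_inv_rev, hui, ← zpow_neg, key, neg_neg])⟩

theorem rotProd_rank_four (a b c : G) :
    rotProd ![a, b, c] 0 1 = a ∧ rotProd ![a, b, c] 1 2 = b ∧ rotProd ![a, b, c] 2 3 = c ∧
    rotProd ![a, b, c] 0 2 = a * b ∧ rotProd ![a, b, c] 1 3 = b * c ∧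
    rotProd ![a, b, c] 0 3 = a * b * c := by
  simp [rotProd, List.ofFn_succ, mul_assoc]

theorem rotProd_mem_rotSubgroup (σ : Fin n → G) {I : Set (Fin (n + 1))} {i j : Fin (n + 1)}
    (hij : i < j) (hi : i ∉ I) (hj : j ∉ I) : rotProd σ i j ∈ rotSubgroup σ I :=
  Subgroup.subset_closure ⟨i, j, hij, hi, hj, rfl⟩

theorem rotSubgroup_compl_pair (σ : Fin n → G) {i j : Fin (n + 1)} (hij : i < j) :
    rotSubgroup σ ({i, j} : Set (Fin (n + 1)))ᶜ = Subgroup.zpowers (rotProd σ i j) := by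
  refine le_antisymm ((Subgroup.closure_le _).2 ?_) ?_
  · rintro g ⟨k, l, hkl, hk, hl, rfl⟩
    simp only [Set.mem_compl_iff, not_not, Set.mem_insert_iff, Set.mem_singleton_iff] at hk hl
    have : k = i ∧ l = j := by grind
    rw [this.1, this.2]
    exact Subgroup.mem_zpowers _
  · rw [Subgroup.zpowers_le]
    exact rotProd_mem_rotSubgroup σ hij (by simp) (by simp)

end RotationSubgroups

/-! ### The intersection property in rank four. -/

section RankFour

variable {G : Type*} [Group G]

/-- In rank four, the intersection property follows from its instances for two complements of
pairs and for two single ranks. -/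
theorem rotSubgroup_inf_rank_four (σ : Fin 3 → G)
    (hpair : ∀ x y z : Fin 4, x ≠ y → x ≠ z → y ≠ z →
      rotSubgroup σ ({x, z} : Set (Fin 4))ᶜ ⊓ rotSubgroup σ ({y, z} : Set (Fin 4))ᶜ = ⊥)
    (hlt : ∀ x y : Fin 4, x < y →
      rotSubgroup σ {x} ⊓ rotSubgroup σ {y} ≤ rotSubgroup σ {x, y}) (I J : Set (Fin 4)) :
    rotSubgroup σ I ⊓ rotSubgroup σ J = rotSubgroup σ (I ∪ J) := by
  have hsingle : ∀ x : Fin 4, rotSubgroup σ ({x} : Set (Fin 4))ᶜ = ⊥ := by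
    intro x
    rw [Subgroup.eq_bot_iff_forall]
    intro g hg
    refine (Subgroup.closure_le ⊥).2 ?_ hg
    rintro _ ⟨i, j, hij, hi, hj, rfl⟩
    simp only [Set.mem_compl_iff, not_not, Set.mem_singleton_iff] at hi hj
    exact absurd hij (by rw [hi, hj]; exact lt_irrefl x)
  refine rotSubgroup_inf_of_erase _ ?_ I J
  intro S x y hx hy hxy
  obtain ⟨W, hW⟩ : ∃ W, W = (S.erase x).erase y := ⟨_, rfl⟩
  have hyx : S.erase x = insert y W := by
    rw [hW, Finset.insert_erase (Finset.mem_erase.2 ⟨hxy.symm, hy⟩)]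
  have hxy' : S.erase y = insert x W := by
    rw [hW, Finset.erase_right_comm, Finset.insert_erase (Finset.mem_erase.2 ⟨hxy, hx⟩)]
  have hxW : x ∉ W := by simp [hW]
  have hyW : y ∉ W := by simp [hW]
  rw [← hW, hyx, hxy']
  have hcard : W.card + 2 ≤ 4 := by
    have h1 := Finset.card_le_univ (insert x (insert y W))
    rwa [Finset.card_insert_of_notMem (by simp [hxy, hxW]), Finset.card_insert_of_notMem hyW] at h1
  -- These cases are, in turn, two trivial groups, two cyclic groups whose pairs share a rank, and
  -- two groups that each omit one rank.
  have hcases : W.card = 0 ∨ W.card = 1 ∨ (insert x (insert y W)).card = Fintype.card (Fin 4) := by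
    rw [Finset.card_insert_of_notMem (by simp [hxy, hxW]), Finset.card_insert_of_notMem hyW]
    simp only [Fintype.card_fin]
    omega
  rcases hcases with h0 | h1 | h2
  · rw [Finset.card_eq_zero.1 h0]
    simp only [insert_empty_eq, Finset.coe_singleton, hsingle, bot_inf_eq, bot_le]
  · obtain ⟨z, rfl⟩ := Finset.card_eq_one.1 h1
    simp only [Finset.mem_singleton] at hxW hyW
    simp only [Finset.coe_insert, Finset.coe_singleton, hpair y x z hxy.symm hyW hxW, bot_le]
  · have huniv := Finset.eq_univ_of_card _ h2
    have hmem : ∀ z, z = x ∨ z = y ∨ z ∈ W := fun z => by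
      have := Finset.mem_univ z
      rw [← huniv] at this
      simpa using this
    have e1 : (↑(insert y W) : Set (Fin 4))ᶜ = {x} := by
      ext z
      have := hmem z
      simp only [Set.mem_compl_iff, Finset.mem_coe, Finset.mem_insert, Set.mem_singleton_iff]
      constructor
      · tauto
      · rintro rfl; tauto
    have e2 : (↑(insert x W) : Set (Fin 4))ᶜ = {y} := by
      ext z
      have := hmem z
      simp only [Set.mem_compl_iff, Finset.mem_coe, Finset.mem_insert, Set.mem_singleton_iff]
      constructor
      · tauto
      · rintro rfl; exact fun h => h.elim hxy.symm hyW
    have e3 : (↑W : Set (Fin 4))ᶜ = {x, y} := by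
      ext z
      have := hmem z
      simp only [Set.mem_compl_iff, Finset.mem_coe, Set.mem_insert_iff, Set.mem_singleton_iff]
      constructor
      · tauto
      · rintro (rfl | rfl) <;> assumption
    rw [e1, e2, e3]
    rcases lt_or_gt_of_ne hxy with h | h
    · exact hlt x y h
    · rw [inf_comm, Set.pair_comm]
      exact hlt y x h

/-- A rank four criterion for the intersection property. -/
theorem intersection_rank_four (a b c : G) (hab : orderOf (a * b) = 2) (hbc : orderOf (b * c) = 2)
    (habc : orderOf (a * b * c) = 2) (ha2 : a * a ≠ 1) (hc2 : c * c ≠ 1)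
    (hA : ∀ k : ℤ, a ^ k ∈ Subgroup.closure {b, c} → a ^ k = 1)
    (hC : ∀ k : ℤ, c ^ k ∈ Subgroup.closure {a, b} → c ^ k = 1)
    (ht : a * b ∉ Subgroup.closure {b, c}) (hs : b * c ∉ Subgroup.closure {a, b})
    (hK : Subgroup.closure {b, c} ⊓ Subgroup.closure {a, b} ≤ Subgroup.zpowers b)
    (hu : ∀ j k : ℤ, a ^ k ≠ c ^ j * (a * b * c)) (I J : Set (Fin 4)) :
    rotSubgroup ![a, b, c] I ⊓ rotSubgroup ![a, b, c] J = rotSubgroup ![a, b, c] (I ∪ J) := by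
  obtain ⟨e01, e12, e23, e02, e13, e03⟩ := rotProd_rank_four a b c
  obtain ⟨u, hut⟩ : ∃ u, u = a * b * c := ⟨_, rfl⟩
  have hus : u = a * (b * c) := by rw [hut, mul_assoc]
  rw [← hut] at habc hu e03
  have tt : (a * b) * (a * b) = 1 := by rw [← sq, ← hab, pow_orderOf_eq_one]
  have ss : (b * c) * (b * c) = 1 := by rw [← sq, ← hbc, pow_orderOf_eq_one]
  have uu : u * u = 1 := by rw [← sq, ← habc, pow_orderOf_eq_one]
  -- Since a⁻¹u = bc and uc⁻¹ = ab are involutions, u inverts both a and c. Hence the groups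
  -- omitting rank 2 and rank 1 lie in the dihedral groups ⟨a, u⟩ and ⟨c, u⟩.
  have uau : u * a * u = a⁻¹ := by
    have h1 : a⁻¹ * u = b * c := by rw [hus]; group
    have h2 : a⁻¹ * u * (a⁻¹ * u) = 1 := by rw [h1, ss]
    have h3 : u * a⁻¹ * u = a := by
      rw [mul_assoc] at h2
      simpa [mul_assoc] using eq_inv_of_mul_eq_one_right h2
    have hui : u⁻¹ = u := inv_eq_of_mul_eq_one_left uu
    calc u * a * u = (u * a⁻¹ * u)⁻¹ := by simp [hui, mul_assoc]
      _ = a⁻¹ := by rw [h3]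
  have ucu' : u * c⁻¹ * u = c := by
    have h1 : u * c⁻¹ = a * b := by rw [hut]; group
    have h2 : u * c⁻¹ * (u * c⁻¹) = 1 := by rw [h1, tt]
    rw [← mul_assoc] at h2
    simpa using eq_inv_of_mul_eq_one_left h2
  have ucu : u * c * u = c⁻¹ := by
    have hui : u⁻¹ = u := inv_eq_of_mul_eq_one_left uu
    calc u * c * u = (u * c⁻¹ * u)⁻¹ := by simp [hui, mul_assoc]
      _ = c⁻¹ := by rw [ucu']
  have cu : c * u = a * b := by
    calc c * u = u * c⁻¹ * u * u := by rw [ucu']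
      _ = u * c⁻¹ := by rw [mul_assoc, uu, mul_one]
      _ = a * b := by rw [hut]; group
  have bK' : b ∈ Subgroup.closure {b, c} := Subgroup.subset_closure (by simp)
  have cK' : c ∈ Subgroup.closure {b, c} := Subgroup.subset_closure (by simp)
  have aK : a ∈ Subgroup.closure {a, b} := Subgroup.subset_closure (by simp)
  have bK : b ∈ Subgroup.closure {a, b} := Subgroup.subset_closure (by simp)
  have tK : a * b ∈ Subgroup.closure {a, b} := mul_mem aK bK
  have sK' : b * c ∈ Subgroup.closure {b, c} := mul_mem bK' cK'
  have uK' : u ∉ Subgroup.closure {b, c} := fun h => ht (by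
    have := mul_mem h (inv_mem cK'); rwa [hut, mul_inv_cancel_right] at this)
  have uK : u ∉ Subgroup.closure {a, b} := fun h => hs (by
    have := mul_mem (inv_mem aK) h; rwa [hus, inv_mul_cancel_left] at this)
  -- upper bounds for the rank three subgroups
  have le0 : rotSubgroup ![a, b, c] {0} ≤ Subgroup.closure {b, c} := by
    refine (Subgroup.closure_le _).2 ?_
    rintro g ⟨i, j, hij, hi, hj, rfl⟩
    fin_cases i <;> fin_cases j <;> simp at hij hi hj <;>
      simp only [Fin.reduceFinMk, Fin.mk_one, e12, e13, e23] <;> assumption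
  have le3 : rotSubgroup ![a, b, c] {3} ≤ Subgroup.closure {a, b} := by
    refine (Subgroup.closure_le _).2 ?_
    rintro g ⟨i, j, hij, hi, hj, rfl⟩
    fin_cases i <;> fin_cases j <;> simp at hij hi hj <;>
      simp only [Fin.reduceFinMk, Fin.mk_one, Fin.zero_eta, e12, e01, e02] <;> assumption
  have le2 : ∀ g ∈ rotSubgroup ![a, b, c] {2}, ∃ k : ℤ, g = a ^ k ∨ g = a ^ k * u := by
    intro g hg
    refine mem_closure_dihedral uu uau ((Subgroup.closure_le _).2 ?_ hg)
    have ha : a ∈ Subgroup.closure {a, u} := Subgroup.subset_closure (by simp)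
    have hu : u ∈ Subgroup.closure {a, u} := Subgroup.subset_closure (by simp)
    have hs : b * c ∈ Subgroup.closure {a, u} := by
      have := mul_mem (inv_mem ha) hu
      rwa [show a⁻¹ * u = b * c by rw [hus, inv_mul_cancel_left]] at this
    rintro g ⟨i, j, hij, hi, hj, rfl⟩
    fin_cases i <;> fin_cases j <;> simp at hij hi hj <;>
      simp only [Fin.reduceFinMk, Fin.mk_one, Fin.zero_eta, e13, e01, e03] <;> assumption
  have le1 : ∀ g ∈ rotSubgroup ![a, b, c] {1}, ∃ k : ℤ, g = c ^ k ∨ g = c ^ k * u := by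
    intro g hg
    refine mem_closure_dihedral uu ucu ((Subgroup.closure_le _).2 ?_ hg)
    have hc : c ∈ Subgroup.closure {c, u} := Subgroup.subset_closure (by simp)
    have hu : u ∈ Subgroup.closure {c, u} := Subgroup.subset_closure (by simp)
    have ht : a * b ∈ Subgroup.closure {c, u} := by
      have := mul_mem hu (inv_mem hc)
      rwa [show u * c⁻¹ = a * b by rw [hut, mul_inv_cancel_right]] at this
    rintro g ⟨i, j, hij, hi, hj, rfl⟩
    fin_cases i <;> fin_cases j <;> simp at hij hi hj <;>
      simp only [Fin.reduceFinMk, Fin.zero_eta, e02, e23, e03] <;> assumption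
  -- the rank two subgroups
  have two : ∀ {g h : G}, orderOf g = 2 → h ∈ Subgroup.zpowers g → h = 1 ∨ h = g := by
    rintro g _ hg ⟨k, rfl⟩
    have h2 : g ^ (2 : ℤ) = 1 := by
      exact_mod_cast hg ▸ pow_orderOf_eq_one g
    rcases Int.even_or_odd' k with ⟨m, rfl | rfl⟩
    · exact Or.inl (by simp [zpow_mul, h2])
    · exact Or.inr (by simp [zpow_add, zpow_mul, h2])
  have ne_one : ∀ {g : G}, orderOf g = 2 → g ≠ 1 := by
    rintro _ h rfl; simp at h
  have inv_two : ∀ {g h : G} (C : Subgroup G), orderOf g = 2 → g ∉ C →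
      h ∈ Subgroup.zpowers g → h ∈ C → h = 1 := by
    intro g h C hg hgC hh hC
    rcases two hg hh with rfl | rfl
    · rfl
    · exact absurd hC hgC
  have ab : ∀ g ∈ Subgroup.zpowers a, g ∈ Subgroup.zpowers b → g = 1 := by
    rintro _ ⟨k, rfl⟩ h
    exact hA k ((Subgroup.zpowers_le.2 bK') h)
  have bc : ∀ g ∈ Subgroup.zpowers c, g ∈ Subgroup.zpowers b → g = 1 := by
    rintro _ ⟨k, rfl⟩ h
    exact hC k ((Subgroup.zpowers_le.2 bK) h)
  have ta : a * b ∉ Subgroup.zpowers a := fun h => by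
    have hb : b = 1 := ab b (by
      have := mul_mem (inv_mem (Subgroup.mem_zpowers a)) h
      rwa [inv_mul_cancel_left] at this) (Subgroup.mem_zpowers b)
    rw [hb, mul_one] at tt
    exact ha2 tt
  have sc : b * c ∉ Subgroup.zpowers c := fun h => by
    have hb : b = 1 := bc b (by
      have := mul_mem h (inv_mem (Subgroup.mem_zpowers c))
      rwa [mul_inv_cancel_right] at this) (Subgroup.mem_zpowers b)
    rw [hb, one_mul] at ss
    exact hc2 ss
  have tb : a * b ∉ Subgroup.zpowers b := fun h => ht (Subgroup.zpowers_le.2 bK' h)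
  have sb : b * c ∉ Subgroup.zpowers b := fun h => hs (Subgroup.zpowers_le.2 bK h)
  have sa : b * c ∉ Subgroup.zpowers a := by
    rintro ⟨k, hk⟩
    exact ne_one hbc (hk ▸ hA k (by rw [show a ^ k = b * c from hk]; exact sK'))
  have tc : a * b ∉ Subgroup.zpowers c := by
    rintro ⟨k, hk⟩
    exact ne_one hab (hk ▸ hC k (by rw [show c ^ k = a * b from hk]; exact tK))
  have ua : u ∉ Subgroup.zpowers a := by
    rintro ⟨k, hk⟩
    exact hu 0 k (by simpa using hk)
  have uc : u ∉ Subgroup.zpowers c := by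
    rintro ⟨k, hk⟩
    exact hu (-k) 0 (by simp [← show c ^ k = u from hk])
  have ut : u ∉ Subgroup.zpowers (a * b) := fun h => by
    rcases two hab h with h | h
    · exact ne_one habc h
    · rw [hut] at h
      exact hc2 (by simp [mul_eq_left.1 h])
  have us : u ∉ Subgroup.zpowers (b * c) := fun h => by
    rcases two hbc h with h | h
    · exact ne_one habc h
    · rw [hus] at h
      exact ha2 (by simp [mul_eq_right.1 h])
  have hpair : ∀ x y z : Fin 4, x ≠ y → x ≠ z → y ≠ z →
      rotSubgroup ![a, b, c] ({x, z} : Set (Fin 4))ᶜ ⊓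
        rotSubgroup ![a, b, c] ({y, z} : Set (Fin 4))ᶜ = ⊥ := by
    have h01 := rotSubgroup_compl_pair ![a, b, c] (i := 0) (j := 1) (by decide)
    have h02 := rotSubgroup_compl_pair ![a, b, c] (i := 0) (j := 2) (by decide)
    have h03 := rotSubgroup_compl_pair ![a, b, c] (i := 0) (j := 3) (by decide)
    have h12 := rotSubgroup_compl_pair ![a, b, c] (i := 1) (j := 2) (by decide)
    have h13 := rotSubgroup_compl_pair ![a, b, c] (i := 1) (j := 3) (by decide)
    have h23 := rotSubgroup_compl_pair ![a, b, c] (i := 2) (j := 3) (by decide)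
    rw [e01] at h01
    rw [e02] at h02
    rw [e03] at h03
    rw [e12] at h12
    rw [e13] at h13
    rw [e23] at h23
    have h10 := h01
    have h20 := h02
    have h30 := h03
    have h21 := h12
    have h31 := h13
    have h32 := h23
    rw [Set.pair_comm] at h10 h20 h30 h21 h31 h32
    intro x y z hxy hxz hyz
    rw [Subgroup.eq_bot_iff_forall]
    rintro g ⟨h1, h2⟩
    revert h1 h2
    -- The generators a and c belong to disjoint pairs of ranks and never meet here. Every case is
    -- thus a against b, b against c, or an involution that lies outside the other cyclic group.
    fin_cases x <;> fin_cases y <;> fin_cases z <;> simp at hxy hxz hyz <;>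
      simp only [Fin.reduceFinMk, Fin.mk_one, Fin.zero_eta, SetLike.mem_coe, h01, h02, h03, h12,
        h13, h23,
        h10, h20, h30, h21, h31, h32] <;> intro h1 h2 <;>
      first
      | exact ab g h1 h2
      | exact ab g h2 h1
      | exact bc g h1 h2
      | exact bc g h2 h1
      | exact inv_two _ habc ‹_› h1 h2
      | exact inv_two _ habc ‹_› h2 h1
      | exact inv_two _ hab ‹_› h1 h2
      | exact inv_two _ hab ‹_› h2 h1
      | exact inv_two _ hbc ‹_› h1 h2
      | exact inv_two _ hbc ‹_› h2 h1
  have mem_pair : ∀ {i j x y : Fin 4} {g : G}, rotProd ![a, b, c] i j = g → i < j →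
      i ∉ ({x, y} : Set (Fin 4)) → j ∉ ({x, y} : Set (Fin 4)) →
      Subgroup.zpowers g ≤ rotSubgroup ![a, b, c] {x, y} := by
    rintro i j x y _ rfl hij hi hj
    rw [Subgroup.zpowers_le]
    exact rotProd_mem_rotSubgroup _ hij hi hj
  have hlt : ∀ x y : Fin 4, x < y →
      rotSubgroup ![a, b, c] {x} ⊓ rotSubgroup ![a, b, c] {y} ≤
        rotSubgroup ![a, b, c] {x, y} := by
    intro x y hxy g ⟨h1, h2⟩
    fin_cases x <;> fin_cases y <;> simp at hxy <;>
      simp only [Fin.reduceFinMk, Fin.mk_one, Fin.zero_eta, SetLike.mem_coe] at h1 h2 ⊢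
    · refine mem_pair e23 (by decide) (by simp) (by simp) ?_
      obtain ⟨k, rfl | rfl⟩ := le1 g h2
      · exact ⟨k, rfl⟩
      · refine absurd ?_ uK'
        have := mul_mem (inv_mem (zpow_mem cK' k)) (le0 h1)
        rwa [inv_mul_cancel_left] at this
    · refine mem_pair e13 (by decide) (by simp) (by simp) ?_
      obtain ⟨k, rfl | rfl⟩ := le2 g h2
      · rw [hA k (le0 h1)]
        exact one_mem _
      -- As bc lies in ⟨b, c⟩, so does the remaining power of a, which is therefore trivial.
      · have hk : a ^ k * u = a ^ (k + 1) * (b * c) := by rw [hus, zpow_add_one, mul_assoc]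
        rw [hk] at h1 ⊢
        rw [hA (k + 1) (by
          simpa only [mul_inv_cancel_right] using mul_mem (le0 h1) (inv_mem sK')), one_mul]
        exact Subgroup.mem_zpowers _
    · exact mem_pair e12 (by decide) (by simp) (by simp) (hK ⟨le0 h1, le3 h2⟩)
    -- Two dihedral groups meet. A rotation of one cannot be a reflection of the other, by `hu`;
    -- otherwise a power of c equals a power of a and is trivial.
    · refine mem_pair e03 (by decide) (by simp) (by simp) ?_
      obtain ⟨k, hk⟩ := le1 g h1
      obtain ⟨l, hl⟩ := le2 g h2
      rcases hk with rfl | rfl <;> rcases hl with hl | hl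
      · rw [hC k (by rw [hl]; exact zpow_mem aK l)]
        exact one_mem _
      · refine absurd ?_ (hu k l)
        rw [hl, mul_assoc, uu, mul_one]
      · exact absurd hl.symm (hu k l)
      · rw [hC k (by rw [mul_right_cancel hl]; exact zpow_mem aK l), one_mul]
        exact Subgroup.mem_zpowers _
    · refine mem_pair e02 (by decide) (by simp) (by simp) ?_
      obtain ⟨k, rfl | rfl⟩ := le1 g h1
      · rw [hC k (le3 h2)]
        exact one_mem _
      · have hk : c ^ k * u = c ^ (k - 1) * (a * b) := by
          rw [← cu, zpow_sub_one, mul_assoc, inv_mul_cancel_left]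
        rw [hk] at h2 ⊢
        rw [hC (k - 1) (by
          simpa only [mul_inv_cancel_right] using mul_mem (le3 h2) (inv_mem tK)), one_mul]
        exact Subgroup.mem_zpowers _
    · refine mem_pair e01 (by decide) (by simp) (by simp) ?_
      obtain ⟨k, rfl | rfl⟩ := le2 g h1
      · exact ⟨k, rfl⟩
      · refine absurd ?_ uK
        have := mul_mem (inv_mem (zpow_mem aK k)) (le3 h2)
        rwa [inv_mul_cancel_left] at this
  exact rotSubgroup_inf_rank_four _ hpair hlt I J

end RankFour

/-! ### Elations, and the obstruction to inverting σ₂ and σ₃. -/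

section Matrices

variable {F : Type*} [Field F]

theorem psl_eq_iff {A B : SL(3, F)} :
    (A : PSL(3, F)) = B ↔ ∃ r : F, r ^ 3 = 1 ∧ (B : Matrix (Fin 3) (Fin 3) F) = r • A.1 := by
  rw [QuotientGroup.eq, Matrix.SpecialLinearGroup.mem_center_iff]
  simp only [Fintype.card_fin]
  refine exists_congr fun r => and_congr_right fun _ => ⟨fun h => ?_, fun h => ?_⟩
  · have : (A * (A⁻¹ * B) : SL(3, F)).1 = A.1 * (A⁻¹ * B : SL(3, F)).1 := rfl
    rw [mul_inv_cancel_left, ← h] at this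
    rw [this, Matrix.scalar_apply, ← Matrix.smul_one_eq_diagonal, mul_smul_comm, mul_one]
  · rw [Matrix.SpecialLinearGroup.coe_mul, h, mul_smul_comm, ← Matrix.SpecialLinearGroup.coe_mul,
      inv_mul_cancel, Matrix.scalar_apply, ← Matrix.smul_one_eq_diagonal,
      Matrix.SpecialLinearGroup.coe_one]

/-- The elations with axis spanned by the last two basis vectors. -/
def elation (p r : F) : SL(3, F) :=
  ⟨!![1, 0, 0; p, 1, 0; r, 0, 1], by simp [Matrix.det_fin_three]⟩

theorem coe_elation (p r : F) :
    (elation p r : Matrix (Fin 3) (Fin 3) F) = !![1, 0, 0; p, 1, 0; r, 0, 1] := rfl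

theorem coe_sigmaMat1 (x : Fˣ) : (sigmaMat1 x : Matrix (Fin 3) (Fin 3) F) =
    !![(x : F), 1, 0; 0, 1 + (x : F)⁻¹, -(x : F)⁻¹; 0, 1, 0] := rfl

theorem coe_sigmaMat2 (x : Fˣ) : (sigmaMat2 x : Matrix (Fin 3) (Fin 3) F) =
    !![-(x : F)⁻¹, 0, 0; 0, 0, 1; 0, (x : F), 0] := rfl

theorem coe_sigmaMat3 (x : Fˣ) : (sigmaMat3 x : Matrix (Fin 3) (Fin 3) F) =
    !![(x : F), 0, 0; (x : F) - (x : F)⁻¹, 1, 0; (x : F) - (x : F)⁻¹, 0, (x : F)⁻¹] := rfl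

theorem elation_mul (p r p' r' : F) :
    elation p r * elation p' r' = elation (p + p') (r + r') := by
  refine Subtype.ext ?_
  simp only [Matrix.SpecialLinearGroup.coe_mul, coe_elation]
  ext i j
  fin_cases i <;> fin_cases j <;> simp [Matrix.mul_apply, Fin.sum_univ_three]

theorem elation_inv (p r : F) : (elation p r)⁻¹ = elation (-p) (-r) := by
  rw [inv_eq_iff_mul_eq_one, elation_mul]
  ext i j
  fin_cases i <;> fin_cases j <;> simp [elation]

theorem psl_elation_injective {p r p' r' : F}
    (h : (elation p r : PSL(3, F)) = elation p' r') : p = p' ∧ r = r' := by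
  obtain ⟨c, -, hc⟩ := psl_eq_iff.1 h
  have h0 := congr_fun₂ hc 0 0
  have h1 := congr_fun₂ hc 1 0
  have h2 := congr_fun₂ hc 2 0
  simp only [coe_elation, Matrix.smul_apply, smul_eq_mul] at h0 h1 h2
  simp at h0 h1 h2
  rw [h1, h2, ← h0]
  simp

/-- `g` acts on the group of elations by scaling the two coordinates. -/
def ScalesElations (g : SL(3, F)) (α β : F) : Prop :=
  ∀ p r, g * elation p r * g⁻¹ = elation (α * p) (β * r)

theorem ScalesElations.mul {g h : SL(3, F)} {α β γ δ : F} (hg : ScalesElations g α β)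
    (hh : ScalesElations h γ δ) : ScalesElations (g * h) (α * γ) (β * δ) := by
  intro p r
  rw [mul_inv_rev, show g * h * elation p r * (h⁻¹ * g⁻¹) = g * (h * elation p r * h⁻¹) * g⁻¹ by
    group, hh, hg, mul_assoc, mul_assoc]

theorem ScalesElations.inv {g : SL(3, F)} {α β : F} (hg : ScalesElations g α β) (hα : α ≠ 0)
    (hβ : β ≠ 0) : ScalesElations g⁻¹ α⁻¹ β⁻¹ := by
  intro p r
  have := hg (α⁻¹ * p) (β⁻¹ * r)
  rw [mul_inv_cancel_left₀ hα, mul_inv_cancel_left₀ hβ] at this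
  rw [← this]
  group

theorem ScalesElations.pow {g : SL(3, F)} {α β : F} (hg : ScalesElations g α β) (k : ℕ) :
    ScalesElations (g ^ k) (α ^ k) (β ^ k) := by
  induction k with
  | zero => intro p r; simp
  | succ k ih =>
    rw [pow_succ, pow_succ, pow_succ]
    exact ih.mul hg

theorem ScalesElations.commutator {g : SL(3, F)} {α β : F} (hg : ScalesElations g α β) (p r : F) :
    ⁅g, elation p r⁆ = elation ((α - 1) * p) ((β - 1) * r) := by
  rw [commutatorElement_def, hg, elation_inv, elation_mul]
  congr 1 <;> ring

variable (x : Fˣ)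

theorem scalesElations_sigmaMat3 :
    ScalesElations (sigmaMat3 x) (x : F)⁻¹ ((x : F)⁻¹ ^ 2) := by
  intro p r
  rw [mul_inv_eq_iff_eq_mul]
  have hx : (x : F) ≠ 0 := x.ne_zero
  refine Subtype.ext ?_
  simp only [Matrix.SpecialLinearGroup.coe_mul, coe_elation, coe_sigmaMat3]
  ext i j
  fin_cases i <;> fin_cases j <;>
    simp [Matrix.mul_apply, Fin.sum_univ_three] <;> field_simp <;> ring

theorem sigmaMat2_sq : (sigmaMat2 x ^ 2 : SL(3, F)).1 =
    !![(x : F)⁻¹ ^ 2, 0, 0; 0, (x : F), 0; 0, 0, (x : F)] := by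
  rw [sq, Matrix.SpecialLinearGroup.coe_mul, coe_sigmaMat2]
  ext i j
  fin_cases i <;> fin_cases j <;> simp [Matrix.mul_apply, Fin.sum_univ_three] <;> ring

theorem scalesElations_sigmaMat2_sq :
    ScalesElations (sigmaMat2 x ^ 2) ((x : F) ^ 3) ((x : F) ^ 3) := by
  intro p r
  rw [mul_inv_eq_iff_eq_mul]
  have hx : (x : F) ≠ 0 := x.ne_zero
  refine Subtype.ext ?_
  simp only [Matrix.SpecialLinearGroup.coe_mul, coe_elation, sigmaMat2_sq]
  ext i j
  fin_cases i <;> fin_cases j <;> simp [Matrix.mul_apply, Fin.sum_univ_three] <;> field_simp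

theorem sigmaMat2_conj_elation (p r : F) :
    sigmaMat2 x * elation p r * (sigmaMat2 x)⁻¹ = elation (-(x * r)) (-(x ^ 2 * p)) := by
  rw [mul_inv_eq_iff_eq_mul]
  have hx : (x : F) ≠ 0 := x.ne_zero
  refine Subtype.ext ?_
  simp only [Matrix.SpecialLinearGroup.coe_mul, coe_elation, coe_sigmaMat2]
  ext i j
  fin_cases i <;> fin_cases j <;> simp [Matrix.mul_apply, Fin.sum_univ_three] <;> field_simp

/-- Modulo elations both matrices are diagonal, so they commute modulo elations. -/
theorem commutator_sigmaMat3_sigmaMat2_sq :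
    ⁅sigmaMat3 x, sigmaMat2 x ^ 2⁆ =
      elation ((x - (x : F)⁻¹) * (x : F)⁻¹ * (1 - x ^ 3))
        ((x - (x : F)⁻¹) * (x : F)⁻¹ * (1 - x ^ 3)) := by
  rw [commutatorElement_def, mul_inv_eq_iff_eq_mul, mul_inv_eq_iff_eq_mul]
  have hx : (x : F) ≠ 0 := x.ne_zero
  refine Subtype.ext ?_
  simp only [Matrix.SpecialLinearGroup.coe_mul, coe_elation, coe_sigmaMat3, sigmaMat2_sq]
  ext i j
  fin_cases i <;> fin_cases j <;>
    simp [Matrix.mul_apply, Fin.sum_univ_three] <;> field_simp <;> ring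

/-- The commutator of g⁻¹ and h⁻¹ is the conjugate of that of g and h by (hg)⁻¹, and here hg
normalises the elations. -/
theorem commutator_inv_sigmaMat3_sigmaMat2_sq :
    ∃ p r, ⁅(sigmaMat3 x)⁻¹, (sigmaMat2 x ^ 2)⁻¹⁆ = elation p r := by
  have hx : (x : F) ≠ 0 := x.ne_zero
  have h := ((scalesElations_sigmaMat2_sq x).mul (scalesElations_sigmaMat3 x)).inv
    (by simp) (by simp)
  have h' := h ((x - (x : F)⁻¹) * (x : F)⁻¹ * (1 - x ^ 3))
    ((x - (x : F)⁻¹) * (x : F)⁻¹ * (1 - x ^ 3))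
  refine ⟨_, _, Eq.trans ?_ h'⟩
  rw [inv_inv, ← commutator_sigmaMat3_sigmaMat2_sq, commutatorElement_def, commutatorElement_def]
  group

/-- The exponents are chosen so that the outer element scales by (x⁻³x⁶, x⁻⁶x⁶) = (x³, 1);
commutation with it kills the second coordinate and keeps the first. -/
theorem exists_commutator_eq_elation (h1 : (x : F) ^ 2 ≠ 1) (h3 : (x : F) ^ 3 ≠ 1) :
    ∃ a, ⁅sigmaMat3 x ^ 3 * (sigmaMat2 x ^ 2) ^ 2, ⁅sigmaMat3 x, sigmaMat2 x ^ 2⁆⁆ =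
      elation a 0 ∧ a ≠ 0 := by
  have hx0 : (x : F) ≠ 0 := x.ne_zero
  have hd : ScalesElations (sigmaMat3 x ^ 3 * (sigmaMat2 x ^ 2) ^ 2) ((x : F) ^ 3) 1 := by
    have := ((scalesElations_sigmaMat3 x).pow 3).mul ((scalesElations_sigmaMat2_sq x).pow 2)
    convert this using 1 <;> field_simp
  refine ⟨_, by rw [commutator_sigmaMat3_sigmaMat2_sq, hd.commutator, sub_self, zero_mul], ?_⟩
  have h1' : (x : F) - (x : F)⁻¹ ≠ 0 := fun h => h1 (by
    rw [sub_eq_zero] at h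
    rw [sq]
    nth_rewrite 2 [h]
    exact mul_inv_cancel₀ hx0)
  have h3' : (1 : F) - x ^ 3 ≠ 0 := fun h => h3 (sub_eq_zero.1 h).symm
  have h3'' : (x : F) ^ 3 - 1 ≠ 0 := fun h => h3 (sub_eq_zero.1 h)
  exact mul_ne_zero h3'' (mul_ne_zero (mul_ne_zero h1' (inv_ne_zero hx0)) h3')

/-- No automorphism of `PSL(3, F)` inverts both `σ₂` and `σ₃`. -/
theorem not_exists_invert [Finite F] (hx : ∀ y : Fˣ, y ∈ Subgroup.zpowers x)
    (h1 : (x : F) ^ 2 ≠ 1) (h3 : (x : F) ^ 3 ≠ 1)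
    (φ : PSL(3, F) ≃* PSL(3, F))
    (hφ2 : φ (sigmaMat2 x : PSL(3, F)) = (sigmaMat2 x : PSL(3, F))⁻¹)
    (hφ3 : φ (sigmaMat3 x : PSL(3, F)) = (sigmaMat3 x : PSL(3, F))⁻¹) : False := by
  have hx0 : (x : F) ≠ 0 := x.ne_zero
  -- This is the outer element of `exists_commutator_eq_elation` with both generators inverted,
  -- hence a representative of its image under φ.
  set d' := (sigmaMat3 x)⁻¹ ^ 3 * ((sigmaMat2 x ^ 2)⁻¹) ^ 2 with hd'_def
  have hd' : ScalesElations d' (((x : F) ^ 3)⁻¹) 1 := by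
    have := (((scalesElations_sigmaMat3 x).inv (by simp) (by simp)).pow 3).mul
      (((scalesElations_sigmaMat2_sq x).inv (by simp) (by simp)).pow 2)
    convert this using 1 <;> field_simp
  obtain ⟨a, ha, ha0⟩ := exists_commutator_eq_elation x h1 h3
  obtain ⟨b, hb⟩ : ∃ b, ⁅d', ⁅(sigmaMat3 x)⁻¹, (sigmaMat2 x ^ 2)⁻¹⁆⁆ = elation b 0 := by
    obtain ⟨p, r, h⟩ := commutator_inv_sigmaMat3_sigmaMat2_sq x
    exact ⟨_, by rw [h, hd'.commutator, sub_self, zero_mul]⟩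
  have hφ : φ (elation a 0 : PSL(3, F)) = (elation b 0 : PSL(3, F)) := by
    rw [← ha, ← hb, hd'_def]
    simp only [commutatorElement_def, QuotientGroup.mk_mul, QuotientGroup.mk_inv,
      QuotientGroup.mk_pow, map_mul, map_inv, map_pow, hφ2, hφ3, inv_pow]
  have hscale : ∀ y : Fˣ, φ (elation (y * a) 0 : PSL(3, F)) =
      (elation ((y : F)⁻¹ * b) 0 : PSL(3, F)) := by
    intro y
    -- The inverse of y appears because σ₃ scales the first coordinate by x⁻¹.
    obtain ⟨k, hk⟩ := (mem_powers_iff_mem_zpowers).2 (hx y⁻¹)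
    have hk' : y = (x ^ k)⁻¹ := by rw [show x ^ k = y⁻¹ from hk, inv_inv]
    have e1 := (scalesElations_sigmaMat3 x).pow k a 0
    have e2 := ((scalesElations_sigmaMat3 x).inv (by simp) (by simp)).pow k b 0
    rw [mul_zero] at e1 e2
    have e1' : ((x : F)⁻¹) ^ k = y := by rw [hk']; simp
    have e2' : ((x : F)⁻¹⁻¹) ^ k = (y : F)⁻¹ := by rw [hk']; simp
    rw [e1'] at e1
    rw [e2'] at e2
    rw [← e1, ← e2]
    simp only [QuotientGroup.mk_mul, QuotientGroup.mk_inv,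
      QuotientGroup.mk_pow, map_mul, map_inv, map_pow, hφ3, hφ, inv_pow, inv_inv]
  -- The map y ↦ y⁻¹ would have to respect the sum 1 + x.
  have hx1 : 1 + (x : F) ≠ 0 := fun h => h1 (by linear_combination ((x : F) - 1) * h)
  have s1 := hscale x
  have s2 := hscale (Units.mk0 (1 + x) hx1)
  simp only [Units.val_mk0] at s2
  have hsum : (elation ((1 + x) * a) 0 : PSL(3, F)) =
      (elation a 0 : PSL(3, F)) * (elation (x * a) 0 : SL(3, F)) := by
    rw [← QuotientGroup.mk_mul, elation_mul, add_zero, add_mul, one_mul]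
  rw [hsum, map_mul, hφ, s1, ← QuotientGroup.mk_mul, elation_mul] at s2
  have hb' := (psl_elation_injective s2).1
  have hb0 : b ≠ 0 := by
    rintro rfl
    have h0 : (elation (0 : F) 0 : PSL(3, F)) = 1 := by
      have : (elation (0 : F) 0) = 1 := by
        have := elation_mul (0 : F) 0 0 0
        simpa using this
      rw [this]; rfl
    rw [h0, ← map_one φ, φ.injective.eq_iff, ← h0] at hφ
    exact ha0 (psl_elation_injective hφ).1
  -- The relation (1 + x)⁻¹ = 1 + x⁻¹ reads x² + x + 1 = 0, and multiplying by x - 1 gives x³ = 1.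
  apply h3
  field_simp at hb'
  linear_combination ((x : F) - 1) * hb'

end Matrices

/-! ### Generation of the point-pair stabiliser in SL(3, F). -/

section PointPair

variable {F : Type*} [Field F]

/-- The shape of the matrices that preserve the line spanned by the last two basis vectors and
permute the points that these two vectors span. -/
def PermutesPoints (A : Matrix (Fin 3) (Fin 3) F) : Prop :=
  A 0 1 = 0 ∧ A 0 2 = 0 ∧ (A 1 2 = 0 ∧ A 2 1 = 0 ∨ A 1 1 = 0 ∧ A 2 2 = 0)

/-- The diagonal matrix with entries `y`, `1`, `y⁻¹`. -/
def diagOuter (y : Fˣ) : SL(3, F) :=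
  ⟨!![(y : F), 0, 0; 0, 1, 0; 0, 0, (y : F)⁻¹], by simp [Matrix.det_fin_three]⟩

/-- The diagonal matrix with entries `y`, `y⁻¹`, `1`. -/
def diagLeft (y : Fˣ) : SL(3, F) :=
  ⟨!![(y : F), 0, 0; 0, (y : F)⁻¹, 0; 0, 0, 1], by simp [Matrix.det_fin_three]⟩

theorem coe_diagOuter (y : Fˣ) : (diagOuter y : Matrix (Fin 3) (Fin 3) F) =
    !![(y : F), 0, 0; 0, 1, 0; 0, 0, (y : F)⁻¹] := rfl

theorem coe_diagLeft (y : Fˣ) : (diagLeft y : Matrix (Fin 3) (Fin 3) F) =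
    !![(y : F), 0, 0; 0, (y : F)⁻¹, 0; 0, 0, 1] := rfl

variable (x : Fˣ)

theorem diagLeft_eq_conj (y : Fˣ) :
    diagLeft y = sigmaMat2 x * diagOuter y * (sigmaMat2 x)⁻¹ := by
  rw [eq_mul_inv_iff_mul_eq]
  refine Subtype.ext ?_
  simp only [Matrix.SpecialLinearGroup.coe_mul, coe_sigmaMat2, coe_diagLeft, coe_diagOuter]
  ext i j
  fin_cases i <;> fin_cases j <;> simp [Matrix.mul_apply, Fin.sum_univ_three, mul_comm]

/-- The value at `y` of the homomorphism `sigma3Pow`. -/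
def sigma3PowMat (y : Fˣ) : SL(3, F) :=
  ⟨!![(y : F), 0, 0; (x + 1) * (x : F)⁻¹ * (y - 1), 1, 0; (y : F) - (y : F)⁻¹, 0, (y : F)⁻¹], by
    simp [Matrix.det_fin_three]⟩

/-- The entries of σ₃ᵏ are Laurent polynomials in y = xᵏ; as functions of y they are multiplicative
on all of `Fˣ`, which gives closed forms for the powers of σ₃. -/
theorem sigma3PowMat_mul (y z : Fˣ) :
    sigma3PowMat x (y * z) = sigma3PowMat x y * sigma3PowMat x z := by
  refine Subtype.ext ?_
  rw [Matrix.SpecialLinearGroup.coe_mul]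
  simp only [sigma3PowMat]
  have hx : (x : F) ≠ 0 := x.ne_zero
  have hy : (y : F) ≠ 0 := y.ne_zero
  have hz : (z : F) ≠ 0 := z.ne_zero
  ext i j
  fin_cases i <;> fin_cases j <;>
    simp [Matrix.mul_apply, Fin.sum_univ_three] <;> field_simp <;> ring

/-- The homomorphism whose value at `x` is `sigmaMat3 x`. -/
def sigma3Pow : Fˣ →* SL(3, F) := MonoidHom.mk' (sigma3PowMat x) (sigma3PowMat_mul x)

theorem coe_sigma3Pow (y : Fˣ) : (sigma3Pow x y : Matrix (Fin 3) (Fin 3) F) =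
    !![(y : F), 0, 0; (x + 1) * (x : F)⁻¹ * (y - 1), 1, 0;
      (y : F) - (y : F)⁻¹, 0, (y : F)⁻¹] := rfl

theorem sigma3Pow_self : sigma3Pow x x = sigmaMat3 x := by
  refine Subtype.ext ?_
  rw [coe_sigma3Pow, coe_sigmaMat3]
  have hx : (x : F) ≠ 0 := x.ne_zero
  ext i j
  fin_cases i <;> fin_cases j <;> simp <;> field_simp <;> ring

/-- The two matrices share their diagonal, and an elation clears the rest of the first column. -/
theorem exists_diagOuter_eq (y : Fˣ) : ∃ p r, diagOuter y = elation p r * sigma3Pow x y := by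
  refine ⟨-((x + 1) * (x : F)⁻¹ * (y - 1) * (y : F)⁻¹), -((y - (y : F)⁻¹) * (y : F)⁻¹), ?_⟩
  refine Subtype.ext ?_
  simp only [Matrix.SpecialLinearGroup.coe_mul, coe_sigma3Pow, coe_elation, coe_diagOuter]
  ext i j
  fin_cases i <;> fin_cases j <;> simp [Matrix.mul_apply, Fin.sum_univ_three]

theorem sigmaMat3_zpow (k : ℤ) : sigmaMat3 x ^ k = sigma3Pow x (x ^ k) := by
  rw [map_zpow, sigma3Pow_self]

theorem mem_closure_of_permutesPoints [Finite F] (hx : ∀ y : Fˣ, y ∈ Subgroup.zpowers x)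
    (h1 : (x : F) ^ 2 ≠ 1) (h3 : (x : F) ^ 3 ≠ 1) (A : SL(3, F)) (hA : PermutesPoints A.1) :
    A ∈ Subgroup.closure {sigmaMat2 x, sigmaMat3 x} := by
  have hx0 : (x : F) ≠ 0 := x.ne_zero
  set H := Subgroup.closure {sigmaMat2 x, sigmaMat3 x}
  have m2 : sigmaMat2 x ∈ H := Subgroup.subset_closure (by simp)
  have m3 : sigmaMat3 x ∈ H := Subgroup.subset_closure (by simp)
  have comm : ∀ {g h : SL(3, F)}, g ∈ H → h ∈ H → ⁅g, h⁆ ∈ H := fun hg hh =>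
    mul_mem (mul_mem (mul_mem hg hh) (inv_mem hg)) (inv_mem hh)
  have hpow : ∀ y, sigma3Pow x y ∈ H := by
    intro y
    obtain ⟨k, rfl⟩ := hx y
    simpa only [← sigmaMat3_zpow] using zpow_mem m3 k
  obtain ⟨a, ha, ha0⟩ := exists_commutator_eq_elation x h1 h3
  have haH : elation a 0 ∈ H := by
    rw [← ha]
    exact comm (mul_mem (pow_mem m3 3) (pow_mem (pow_mem m2 2) 2)) (comm m3 (pow_mem m2 2))
  have hE1 : ∀ p, elation p 0 ∈ H := by
    intro p
    by_cases hp : p = 0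
    · rw [hp]
      have := mul_mem haH (inv_mem haH)
      rwa [elation_inv, elation_mul, add_neg_cancel, add_neg_cancel] at this
    obtain ⟨k, hk⟩ := mem_powers_iff_mem_zpowers.2 (hx (Units.mk0 (p / a) (div_ne_zero hp ha0))⁻¹)
    have e1 := (scalesElations_sigmaMat3 x).pow k a 0
    have e2 : (x : F)⁻¹ ^ k * a = p := by
      have : (x : F) ^ k = (p / a)⁻¹ := by simpa using congrArg Units.val hk
      rw [inv_pow, this, inv_inv, div_mul_cancel₀ _ ha0]
    rw [e2, mul_zero] at e1
    rw [← e1]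
    exact mul_mem (mul_mem (pow_mem m3 k) haH) (inv_mem (pow_mem m3 k))
  have hE : ∀ p r, elation p r ∈ H := by
    intro p r
    -- Conjugation by σ₂ moves the first coordinate to the second with factor -x², which this
    -- argument compensates.
    have h2 := mul_mem (mul_mem m2 (hE1 (-(x : F)⁻¹ ^ 2 * r))) (inv_mem m2)
    rw [sigmaMat2_conj_elation] at h2
    have := mul_mem (hE1 p) h2
    rw [elation_mul] at this
    convert this using 2
    · simp
    · field_simp
      simp
  have hD : ∀ y, diagOuter y ∈ H := by
    intro y
    obtain ⟨p, r, h⟩ := exists_diagOuter_eq x y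
    rw [h]
    exact mul_mem (hE p r) (hpow y)
  have key : ∀ B : SL(3, F), B.1 0 1 = 0 → B.1 0 2 = 0 → B.1 1 2 = 0 → B.1 2 1 = 0 → B ∈ H := by
    intro B h01 h02 h12 h21
    have hdet := B.2
    rw [Matrix.det_fin_three] at hdet
    simp only [h01, h02, h12, h21, mul_zero, zero_mul, sub_zero, add_zero] at hdet
    have hs : B.1 1 1 ≠ 0 := by rintro h; simp [h] at hdet
    have ht : B.1 2 2 ≠ 0 := by rintro h; simp [h] at hdet
    have h0 : B.1 0 0 = (B.1 1 1)⁻¹ * (B.1 2 2)⁻¹ := by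
      field_simp
      linear_combination hdet
    -- The diagonal factors produce the diagonal of B. The elation entries are those of the first
    -- column divided by `B.1 0 0`, whose inverse is the product of the other two diagonal entries.
    have hB : B = elation (B.1 1 0 * (B.1 1 1 * B.1 2 2)) (B.1 2 0 * (B.1 1 1 * B.1 2 2)) *
        (diagOuter (Units.mk0 _ ht)⁻¹ * diagLeft (Units.mk0 _ hs)⁻¹) := by
      refine Subtype.ext ?_
      simp only [Matrix.SpecialLinearGroup.coe_mul, coe_elation, coe_diagOuter, coe_diagLeft]
      ext i j
      fin_cases i <;> fin_cases j <;>
        simp [Matrix.mul_apply, Fin.sum_univ_three, h01, h02, h12, h21, h0] <;> field_simp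
    rw [hB, diagLeft_eq_conj x]
    exact mul_mem (hE _ _) (mul_mem (hD _) (mul_mem (mul_mem m2 (hD _)) (inv_mem m2)))
  obtain ⟨h01, h02, h | h⟩ := hA
  · exact key A h01 h02 h.1 h.2
  · have : sigmaMat2 x * A ∈ H := by
      apply key <;> rw [Matrix.SpecialLinearGroup.coe_mul, coe_sigmaMat2] <;>
        simp [Matrix.mul_apply, Fin.sum_univ_three, h01, h02, h.1, h.2]
    simpa only [inv_mul_cancel_left] using mul_mem (inv_mem m2) this

end PointPair

/-! ### The point-pair stabiliser in PSL(3, F). -/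

section Stabilizers

variable {F : Type*} [Field F]

theorem psl_smul_span_single_iff (A : SL(3, F)) (i j : Fin 3) :
    (A : PSL(3, F)) • (Submodule.span F {(Pi.single i 1 : Fin 3 → F)}) =
      Submodule.span F {(Pi.single j 1 : Fin 3 → F)} ↔ ∀ k, k ≠ j → A.1 k i = 0 := by
  rw [psl_smul_coe, Submodule.map_span, Set.image_singleton,
    Submodule.span_singleton_eq_span_singleton]
  simp only [Matrix.toLin'_apply, Matrix.mulVec_single_one]
  constructor
  · rintro ⟨z, hz⟩ k hk
    have := congr_fun hz k
    simpa [hk, Units.smul_def] using this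
  · intro h
    have hj : A.1 j i ≠ 0 := by
      intro hj
      have : ∀ k, A.1 k i = 0 := fun k => by
        by_cases hk : k = j
        · rw [hk, hj]
        · exact h k hk
      exact A.det_ne_zero (Matrix.det_eq_zero_of_column_eq_zero i this)
    refine ⟨(Units.mk0 _ hj)⁻¹, ?_⟩
    ext k
    by_cases hk : k = j
    · subst hk
      simp [Units.smul_def, hj]
    · simp [hk, h k hk]

theorem mem_stabilizer_points_iff (A : SL(3, F)) :
    (A : PSL(3, F)) ∈ MulAction.stabilizer PSL(3, F)
      ({Submodule.span F {Pi.single 1 1}, Submodule.span F {Pi.single 2 1}} :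
        Set (Submodule F (Fin 3 → F))) ↔ PermutesPoints A.1 := by
  rw [MulAction.mem_stabilizer_iff, ← Set.image_smul, Set.image_pair, Set.pair_eq_pair_iff]
  simp only [psl_smul_span_single_iff, Fin.forall_fin_succ, PermutesPoints]
  simp
  tauto

variable (x : Fˣ)

theorem permutesPoints_sigmaMat2 : PermutesPoints (sigmaMat2 x).1 := by
  simp [PermutesPoints, coe_sigmaMat2]

theorem permutesPoints_sigmaMat3 : PermutesPoints (sigmaMat3 x).1 := by
  simp [PermutesPoints, coe_sigmaMat3]

theorem closure_sigma_points [Finite F] (hx : ∀ y : Fˣ, y ∈ Subgroup.zpowers x)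
    (h1 : (x : F) ^ 2 ≠ 1) (h3 : (x : F) ^ 3 ≠ 1) :
    Subgroup.closure {(sigmaMat2 x : PSL(3, F)), (sigmaMat3 x : PSL(3, F))} =
      MulAction.stabilizer PSL(3, F)
      ({Submodule.span F {Pi.single 1 1}, Submodule.span F {Pi.single 2 1}} :
        Set (Submodule F (Fin 3 → F))) := by
  refine le_antisymm ((Subgroup.closure_le _).2 ?_) ?_
  · rintro _ (rfl | rfl)
    · exact (mem_stabilizer_points_iff _).2 (permutesPoints_sigmaMat2 x)
    · exact (mem_stabilizer_points_iff _).2 (permutesPoints_sigmaMat3 x)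
  · intro g hg
    obtain ⟨A, rfl⟩ := QuotientGroup.mk_surjective g
    have hA := mem_closure_of_permutesPoints x hx h1 h3 A ((mem_stabilizer_points_iff A).1 hg)
    have := Subgroup.mem_map_of_mem (QuotientGroup.mk' (Subgroup.center SL(3, F))) hA
    rw [MonoidHom.map_closure, Set.image_pair] at this
    exact this

end Stabilizers

/-! ### Automorphisms induced by polarities. -/

section Polarity

variable {F : Type*} [Field F] {n : Type*} [Fintype n] [DecidableEq n]

open Matrix

/-- The action on `SL(n, F)` of the polarity with Gram matrix `Q`. -/
noncomputable def polarHom (Q : Matrix n n F) (hQ : IsUnit Q.det) :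
    SpecialLinearGroup n F →* SpecialLinearGroup n F where
  toFun A := ⟨Q⁻¹ * (A⁻¹ : SpecialLinearGroup n F).1ᵀ * Q, by
    rw [det_mul, det_mul, det_transpose, Matrix.SpecialLinearGroup.det_coe, mul_one, ← det_mul,
      nonsing_inv_mul _ hQ, det_one]⟩
  map_one' := Subtype.ext (by simp [nonsing_inv_mul _ hQ])
  map_mul' A B := Subtype.ext (by
    change _ = Q⁻¹ * (A⁻¹ : SpecialLinearGroup n F).1ᵀ * Q *
      (Q⁻¹ * (B⁻¹ : SpecialLinearGroup n F).1ᵀ * Q)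
    simp only [_root_.mul_inv_rev, Matrix.SpecialLinearGroup.coe_mul, transpose_mul,
      Matrix.mul_assoc]
    rw [mul_nonsing_inv_cancel_left _ _ hQ])

theorem polarHom_spec (Q : Matrix n n F) (hQ : IsUnit Q.det) (A : SpecialLinearGroup n F) :
    A.1ᵀ * Q * (polarHom Q hQ A).1 = Q := by
  change A.1ᵀ * Q * (Q⁻¹ * (A⁻¹ : SpecialLinearGroup n F).1ᵀ * Q) = Q
  rw [Matrix.mul_assoc Q⁻¹, Matrix.mul_assoc, mul_nonsing_inv_cancel_left _ _ hQ,
    ← Matrix.mul_assoc, ← transpose_mul, ← Matrix.SpecialLinearGroup.coe_mul, inv_mul_cancel,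
    Matrix.SpecialLinearGroup.coe_one, transpose_one, Matrix.one_mul]

theorem polarHom_eq_of_mul_eq (Q : Matrix n n F) (hQ : IsUnit Q.det) {A B : SpecialLinearGroup n F}
    (h : A.1ᵀ * Q * B.1 = Q) : polarHom Q hQ A = B := by
  refine Subtype.ext ?_
  have hA : IsUnit (A.1ᵀ * Q) := by
    rw [isUnit_iff_isUnit_det, det_mul, det_transpose, A.2, one_mul]
    exact hQ
  exact hA.mul_left_cancel ((polarHom_spec Q hQ A).trans h.symm)

theorem polarHom_polarHom (Q : Matrix n n F) (hQ : IsUnit Q.det) (hs : Qᵀ = Q)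
    (A : SpecialLinearGroup n F) : polarHom Q hQ (polarHom Q hQ A) = A := by
  refine polarHom_eq_of_mul_eq Q hQ ?_
  have := congrArg transpose (polarHom_spec Q hQ A)
  rwa [transpose_mul, transpose_mul, transpose_transpose, hs, ← Matrix.mul_assoc] at this

/-- The involutory automorphism of `SL(n, F)` induced by a polarity. -/
noncomputable def polarEquiv (Q : Matrix n n F) (hQ : IsUnit Q.det) (hs : Qᵀ = Q) :
    SpecialLinearGroup n F ≃* SpecialLinearGroup n F :=
  (polarHom Q hQ).toMulEquiv (polarHom Q hQ) (MonoidHom.ext (polarHom_polarHom Q hQ hs))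
    (MonoidHom.ext (polarHom_polarHom Q hQ hs))

/-- The automorphism of `PSL(n, F)` induced by a polarity. -/
noncomputable def pslPolarEquiv (Q : Matrix n n F) (hQ : IsUnit Q.det) (hs : Qᵀ = Q) :
    ProjectiveSpecialLinearGroup n F ≃* ProjectiveSpecialLinearGroup n F :=
  QuotientGroup.congr _ _ (polarEquiv Q hQ hs)
    (Subgroup.characteristic_iff_map_eq.1 inferInstance _)

theorem pslPolarEquiv_mk (Q : Matrix n n F) (hQ : IsUnit Q.det) (hs : Qᵀ = Q)
    (A : SpecialLinearGroup n F) :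
    pslPolarEquiv Q hQ hs (A : ProjectiveSpecialLinearGroup n F) =
      (polarHom Q hQ A : SpecialLinearGroup n F) := rfl

theorem pslPolarEquiv_pslPolarEquiv (Q : Matrix n n F) (hQ : IsUnit Q.det) (hs : Qᵀ = Q)
    (g : ProjectiveSpecialLinearGroup n F) :
    pslPolarEquiv Q hQ hs (pslPolarEquiv Q hQ hs g) = g := by
  obtain ⟨A, rfl⟩ := QuotientGroup.mk_surjective g
  rw [pslPolarEquiv_mk, pslPolarEquiv_mk, polarHom_polarHom Q hQ hs]

theorem psl_smul_orthogonal {n : ℕ} (Q : Matrix (Fin n) (Fin n) F) (hQ : IsUnit Q.det) (hs : Qᵀ = Q)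
    (g : PSL(n, F)) (W : Submodule F (Fin n → F)) :
    g • (toBilin' Q).orthogonal W = (toBilin' Q).orthogonal (pslPolarEquiv Q hQ hs g • W) := by
  obtain ⟨A, rfl⟩ := QuotientGroup.mk_surjective g
  rw [pslPolarEquiv_mk, psl_smul_coe, psl_smul_coe]
  -- A and its image preserve the form jointly, one in each argument; orthogonality is transported
  -- by this identity.
  have key : ∀ v w, toBilin' Q ((polarHom Q hQ A).1 *ᵥ v) (A.1 *ᵥ w) = toBilin' Q v w := by
    intro v w
    have h := polarHom_spec Q hQ (polarHom Q hQ A)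
    rw [polarHom_polarHom Q hQ hs] at h
    rw [toBilin'_apply', toBilin'_apply', mulVec_mulVec, dotProduct_mulVec, vecMul_mulVec,
      ← Matrix.mul_assoc, h, dotProduct_mulVec]
  ext v
  simp only [LinearMap.BilinForm.mem_orthogonal_iff, Submodule.mem_map, toLin'_apply]
  constructor
  · rintro ⟨w, hw, rfl⟩ _ ⟨m, hm, rfl⟩
    change toBilin' Q _ _ = 0
    rw [key]
    exact hw m hm
  · intro h
    have hv : A.1 *ᵥ ((A⁻¹ : SpecialLinearGroup (Fin n) F).1 *ᵥ v) = v := by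
      rw [mulVec_mulVec, ← Matrix.SpecialLinearGroup.coe_mul, mul_inv_cancel,
        Matrix.SpecialLinearGroup.coe_one,
        one_mulVec]
    refine ⟨_, fun m hm => ?_, hv⟩
    have := h _ ⟨m, hm, rfl⟩
    change toBilin' Q _ _ = 0 at this
    rw [← hv, key] at this
    exact this

end Polarity

/-! ### The polarity behind self-duality, and the line-pair stabiliser. -/

section SigmaPolarity

variable {F : Type*} [Field F] (x : Fˣ)

open Matrix

/-- Gram matrix of the polarity that induces the self-duality of the triple `sigma x`. -/
def sigmaGram : Matrix (Fin 3) (Fin 3) F :=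
  !![((x : F) - 1) ^ 2 * (x + 1) * (x : F)⁻¹, 0, 0; 0, (x : F), -1; 0, -1, 1]

theorem sigmaGram_transpose : (sigmaGram x)ᵀ = sigmaGram x := by
  ext i j
  fin_cases i <;> fin_cases j <;> simp [sigmaGram]

theorem sub_one_ne_zero_of_sq {y : F} (h1 : y ^ 2 ≠ 1) : y - 1 ≠ 0 := fun h =>
  h1 (by linear_combination (y + 1) * h)

theorem add_one_ne_zero_of_sq {y : F} (h1 : y ^ 2 ≠ 1) : y + 1 ≠ 0 := fun h =>
  h1 (by linear_combination (y - 1) * h)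

theorem isUnit_det_sigmaGram (h1 : (x : F) ^ 2 ≠ 1) : IsUnit (sigmaGram x).det := by
  rw [isUnit_iff_ne_zero, sigmaGram, det_fin_three]
  simp only [of_apply, cons_val', cons_val_zero, cons_val_one, cons_val, cons_val_fin_one]
  have e : ((x : F) - 1) ^ 2 * (x + 1) * (x : F)⁻¹ * x * 1 -
      ((x : F) - 1) ^ 2 * (x + 1) * (x : F)⁻¹ * -1 * -1 - 0 * 0 * 1 + 0 * -1 * 0 + 0 * 0 * -1 -
      0 * x * 0 = ((x : F) - 1) ^ 2 * (x + 1) * (x : F)⁻¹ * (x - 1) := by ring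
  rw [e]
  exact mul_ne_zero (mul_ne_zero (mul_ne_zero (pow_ne_zero 2 (sub_one_ne_zero_of_sq h1))
    (add_one_ne_zero_of_sq h1)) (inv_ne_zero x.ne_zero)) (sub_one_ne_zero_of_sq h1)

/-- The hypothesis says that B is the adjoint of A for the form Q. It is linear in the entries of A
and of B, so no inverse has to be computed. -/
theorem polarHom_eq_inv {n : Type*} [Fintype n] [DecidableEq n] {Q : Matrix n n F}
    (hQ : IsUnit Q.det) {A B : Matrix.SpecialLinearGroup n F} (h : A.1ᵀ * Q = Q * B.1) :
    polarHom Q hQ A = B⁻¹ := by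
  refine polarHom_eq_of_mul_eq Q hQ ?_
  rw [h, Matrix.mul_assoc, ← Matrix.SpecialLinearGroup.coe_mul, mul_inv_cancel,
    Matrix.SpecialLinearGroup.coe_one, Matrix.mul_one]

theorem transpose_mul_eq_mul_polarHom_inv {n : Type*} [Fintype n] [DecidableEq n]
    {Q : Matrix n n F} (hQ : IsUnit Q.det) (A : Matrix.SpecialLinearGroup n F) :
    A.1ᵀ * Q = Q * ((polarHom Q hQ A)⁻¹ : Matrix.SpecialLinearGroup n F).1 := by
  have h := congrArg (· * ((polarHom Q hQ A)⁻¹ : Matrix.SpecialLinearGroup n F).1)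
    (polarHom_spec Q hQ A)
  rwa [Matrix.mul_assoc, ← Matrix.SpecialLinearGroup.coe_mul,
    mul_inv_cancel, Matrix.SpecialLinearGroup.coe_one, Matrix.mul_one] at h

/-- The self-duality of the triple `sigma x`. -/
noncomputable def sigmaDuality (h1 : (x : F) ^ 2 ≠ 1) : PSL(3, F) ≃* PSL(3, F) :=
  pslPolarEquiv (sigmaGram x) (isUnit_det_sigmaGram x h1) (sigmaGram_transpose x)

variable {x} (h1 : (x : F) ^ 2 ≠ 1)

theorem sigmaDuality_sigmaDuality (g : PSL(3, F)) :
    sigmaDuality x h1 (sigmaDuality x h1 g) = g :=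
  pslPolarEquiv_pslPolarEquiv _ _ _ g

theorem sigmaDuality_mk_of_mul_eq {A B : SL(3, F)} (h : A.1ᵀ * sigmaGram x = sigmaGram x * B.1) :
    sigmaDuality x h1 (A : PSL(3, F)) = (B : PSL(3, F))⁻¹ := by
  rw [sigmaDuality, pslPolarEquiv_mk, polarHom_eq_inv _ h, QuotientGroup.mk_inv]

theorem exists_sigmaDuality_mk (A : SL(3, F)) :
    ∃ B : SL(3, F), A.1ᵀ * sigmaGram x = sigmaGram x * B.1 ∧
      sigmaDuality x h1 (A : PSL(3, F)) = (B : PSL(3, F))⁻¹ :=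
  ⟨_, transpose_mul_eq_mul_polarHom_inv (isUnit_det_sigmaGram x h1) A,
    sigmaDuality_mk_of_mul_eq h1 (transpose_mul_eq_mul_polarHom_inv _ A)⟩

theorem sigmaDuality_sigma1 :
    sigmaDuality x h1 (sigmaMat1 x : PSL(3, F)) = (sigmaMat3 x : PSL(3, F))⁻¹ := by
  refine sigmaDuality_mk_of_mul_eq h1 ?_
  rw [coe_sigmaMat1, coe_sigmaMat3, sigmaGram]
  have hx : (x : F) ≠ 0 := x.ne_zero
  ext i j
  fin_cases i <;> fin_cases j <;>
    simp [Matrix.mul_apply, Fin.sum_univ_three] <;> field_simp <;> ring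

theorem sigmaDuality_sigma2 :
    sigmaDuality x h1 (sigmaMat2 x : PSL(3, F)) = (sigmaMat2 x : PSL(3, F))⁻¹ := by
  refine sigmaDuality_mk_of_mul_eq h1 ?_
  rw [coe_sigmaMat2, sigmaGram]
  have hx : (x : F) ≠ 0 := x.ne_zero
  ext i j
  fin_cases i <;> fin_cases j <;> simp [Matrix.mul_apply, Fin.sum_univ_three] <;> field_simp

theorem sigmaDuality_sigma3 :
    sigmaDuality x h1 (sigmaMat3 x : PSL(3, F)) = (sigmaMat1 x : PSL(3, F))⁻¹ := by
  rw [← sigmaDuality_sigmaDuality h1 (sigmaMat1 x : PSL(3, F)), sigmaDuality_sigma1, map_inv,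
    inv_inv]

theorem mem_closure_lines_iff (g : PSL(3, F)) :
    g ∈ Subgroup.closure {(sigmaMat1 x : PSL(3, F)), (sigmaMat2 x : PSL(3, F))} ↔
      sigmaDuality x h1 g ∈
        Subgroup.closure {(sigmaMat2 x : PSL(3, F)), (sigmaMat3 x : PSL(3, F))} := by
  have m1 : (sigmaMat1 x : PSL(3, F)) ∈
      Subgroup.closure {(sigmaMat1 x : PSL(3, F)), (sigmaMat2 x : PSL(3, F))} :=
    Subgroup.subset_closure (by simp)
  have m2 : (sigmaMat2 x : PSL(3, F)) ∈
      Subgroup.closure {(sigmaMat1 x : PSL(3, F)), (sigmaMat2 x : PSL(3, F))} :=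
    Subgroup.subset_closure (by simp)
  have m2' : (sigmaMat2 x : PSL(3, F)) ∈
      Subgroup.closure {(sigmaMat2 x : PSL(3, F)), (sigmaMat3 x : PSL(3, F))} :=
    Subgroup.subset_closure (by simp)
  have m3 : (sigmaMat3 x : PSL(3, F)) ∈
      Subgroup.closure {(sigmaMat2 x : PSL(3, F)), (sigmaMat3 x : PSL(3, F))} :=
    Subgroup.subset_closure (by simp)
  constructor
  · intro h
    induction h using Subgroup.closure_induction with
    | mem g hg =>
      rcases hg with rfl | rfl
      · rw [sigmaDuality_sigma1]
        exact inv_mem m3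
      · rw [sigmaDuality_sigma2]
        exact inv_mem m2'
    | one => rw [map_one]; exact one_mem _
    | mul g h _ _ hg hh => rw [map_mul]; exact mul_mem hg hh
    | inv g _ hg => rw [map_inv]; exact inv_mem hg
  · have key : ∀ g ∈ Subgroup.closure {(sigmaMat2 x : PSL(3, F)), (sigmaMat3 x : PSL(3, F))},
        sigmaDuality x h1 g ∈
          Subgroup.closure {(sigmaMat1 x : PSL(3, F)), (sigmaMat2 x : PSL(3, F))} := by
      intro g h
      induction h using Subgroup.closure_induction with
      | mem g hg =>
        rcases hg with rfl | rfl
        · rw [sigmaDuality_sigma2]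
          exact inv_mem m2
        · rw [sigmaDuality_sigma3]
          exact inv_mem m1
      | one => rw [map_one]; exact one_mem _
      | mul g h _ _ hg hh => rw [map_mul]; exact mul_mem hg hh
      | inv g _ hg => rw [map_inv]; exact inv_mem hg
    intro h
    simpa only [sigmaDuality_sigmaDuality] using key _ h

theorem nondegenerate_sigmaGram (h1 : (x : F) ^ 2 ≠ 1) : (toBilin' (sigmaGram x)).Nondegenerate :=
  LinearMap.BilinForm.nondegenerate_toBilin'_of_det_ne_zero' _ (isUnit_det_sigmaGram x h1).ne_zero

theorem closure_sigma_lines [Finite F] (h1 : (x : F) ^ 2 ≠ 1)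
    (hx : ∀ y : Fˣ, y ∈ Subgroup.zpowers x)
    (h3 : (x : F) ^ 3 ≠ 1) :
    Subgroup.closure {(sigmaMat1 x : PSL(3, F)), (sigmaMat2 x : PSL(3, F))} =
      MulAction.stabilizer PSL(3, F)
      ({(toBilin' (sigmaGram x)).orthogonal (Submodule.span F {Pi.single 1 1}),
        (toBilin' (sigmaGram x)).orthogonal (Submodule.span F {Pi.single 2 1})} :
        Set (Submodule F (Fin 3 → F))) := by
  have hnd := nondegenerate_sigmaGram h1
  have hrefl : (toBilin' (sigmaGram x)).IsRefl :=
    (Matrix.isSymm_toBilin'_iff_isSymm.2 (sigmaGram_transpose x)).isRefl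
  have hinj : Function.Injective (toBilin' (sigmaGram x)).orthogonal :=
    Function.LeftInverse.injective (LinearMap.BilinForm.orthogonal_orthogonal hnd hrefl)
  ext g
  rw [mem_closure_lines_iff h1, closure_sigma_points x hx h1 h3, MulAction.mem_stabilizer_iff,
    MulAction.mem_stabilizer_iff, ← Set.image_smul, Set.image_pair, Set.pair_eq_pair_iff,
    ← Set.image_smul, Set.image_pair, Set.pair_eq_pair_iff]
  have e : ∀ W, g • (toBilin' (sigmaGram x)).orthogonal W =
      (toBilin' (sigmaGram x)).orthogonal (sigmaDuality x h1 g • W) := fun W => 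
    psl_smul_orthogonal _ (isUnit_det_sigmaGram x h1) (sigmaGram_transpose x) g W
  simp only [e, hinj.eq_iff]

end SigmaPolarity

/-! ### Orders of the generators, and membership tests on matrix entries. -/

section SigmaFacts

open Matrix

variable {F : Type*} [Field F] (x : Fˣ)

theorem sigmaMat12_mul : (sigmaMat1 x * sigmaMat2 x : SL(3, F)).1 =
    !![-1, 0, 1; 0, -1, 1 + (x : F)⁻¹; 0, 0, 1] := by
  rw [Matrix.SpecialLinearGroup.coe_mul, coe_sigmaMat1, coe_sigmaMat2]
  ext i j
  fin_cases i <;> fin_cases j <;> simp [Matrix.mul_apply, Fin.sum_univ_three]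

theorem sigmaMat123_mul : (sigmaMat1 x * sigmaMat2 x * sigmaMat3 x : SL(3, F)).1 =
    !![-(x : F)⁻¹, 0, (x : F)⁻¹;
      (x - (x : F)⁻¹) * (x : F)⁻¹, -1, (1 + (x : F)⁻¹) * (x : F)⁻¹;
      (x - (x : F)⁻¹), 0, (x : F)⁻¹] := by
  rw [Matrix.SpecialLinearGroup.coe_mul, sigmaMat12_mul, coe_sigmaMat3]
  ext i j
  fin_cases i <;> fin_cases j <;> simp [Matrix.mul_apply, Fin.sum_univ_three] <;> ring

theorem orderOf_sigma12 :
    orderOf ((sigmaMat1 x : PSL(3, F)) * (sigmaMat2 x : PSL(3, F))) = 2 := by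
  refine orderOf_eq_prime ?_ ?_
  · have : (sigmaMat1 x * sigmaMat2 x : SL(3, F)) ^ 2 = 1 := by
      refine Subtype.ext ?_
      rw [sq, Matrix.SpecialLinearGroup.coe_mul, sigmaMat12_mul]
      ext i j
      fin_cases i <;> fin_cases j <;> simp [Matrix.mul_apply, Fin.sum_univ_three]
    rw [← QuotientGroup.mk_mul, ← QuotientGroup.mk_pow, this, QuotientGroup.mk_one]
  · rw [← QuotientGroup.mk_mul, ← QuotientGroup.mk_one, ne_eq, eq_comm, psl_eq_iff]
    rintro ⟨r, -, h⟩
    have := congr_fun₂ h 0 2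
    rw [sigmaMat12_mul] at this
    simp at this

theorem orderOf_sigma123 :
    orderOf ((sigmaMat1 x : PSL(3, F)) * (sigmaMat2 x : PSL(3, F)) * (sigmaMat3 x : PSL(3, F))) =
      2 := by
  have hx : (x : F) ≠ 0 := x.ne_zero
  refine orderOf_eq_prime ?_ ?_
  · have : (sigmaMat1 x * sigmaMat2 x * sigmaMat3 x : SL(3, F)) ^ 2 = 1 := by
      refine Subtype.ext ?_
      rw [sq, Matrix.SpecialLinearGroup.coe_mul, sigmaMat123_mul]
      ext i j
      fin_cases i <;> fin_cases j <;>
        simp [Matrix.mul_apply, Fin.sum_univ_three] <;> field_simp <;> ring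
    rw [← QuotientGroup.mk_mul, ← QuotientGroup.mk_mul, ← QuotientGroup.mk_pow, this,
      QuotientGroup.mk_one]
  · rw [← QuotientGroup.mk_mul, ← QuotientGroup.mk_mul, ← QuotientGroup.mk_one, ne_eq, eq_comm,
      psl_eq_iff]
    rintro ⟨r, -, h⟩
    have := congr_fun₂ h 0 2
    rw [sigmaMat123_mul] at this
    simp at this

theorem sigma3Pow_mk_eq_one_iff (y : Fˣ) : (sigma3Pow x y : PSL(3, F)) = 1 ↔ y = 1 := by
  constructor
  · intro h
    rw [← QuotientGroup.mk_one, eq_comm, psl_eq_iff] at h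
    obtain ⟨r, -, h⟩ := h
    have h0 := congr_fun₂ h 0 0
    have h1 := congr_fun₂ h 1 1
    rw [coe_sigma3Pow] at h0 h1
    simp at h0 h1
    rw [← h1] at h0
    exact Units.ext h0
  · rintro rfl
    rw [map_one, QuotientGroup.mk_one]

theorem sigma3_zpow_mk (k : ℤ) :
    (sigmaMat3 x : PSL(3, F)) ^ k = (sigma3Pow x (x ^ k) : PSL(3, F)) := by
  rw [← QuotientGroup.mk_zpow, sigmaMat3_zpow]

theorem orderOf_sigma3 : orderOf (sigmaMat3 x : PSL(3, F)) = orderOf x := by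
  refine orderOf_eq_orderOf_iff.2 fun n => ?_
  have := sigma3Pow_mk_eq_one_iff x (x ^ (n : ℤ))
  rw [← sigma3_zpow_mk] at this
  simpa using this

theorem sigmaMat2_sq_pow (k : ℕ) : ((sigmaMat2 x ^ 2) ^ k : SL(3, F)).1 =
    !![((x : F)⁻¹ ^ 2) ^ k, 0, 0; 0, (x : F) ^ k, 0; 0, 0, (x : F) ^ k] := by
  induction k with
  | zero =>
    rw [pow_zero, Matrix.SpecialLinearGroup.coe_one]
    ext i j
    fin_cases i <;> fin_cases j <;> simp
  | succ k ih =>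
    rw [pow_succ, Matrix.SpecialLinearGroup.coe_mul, ih, sigmaMat2_sq]
    ext i j
    fin_cases i <;> fin_cases j <;> simp [Matrix.mul_apply, Fin.sum_univ_three, pow_succ]

/-- The square of σ₂ is x times diag(x⁻³, 1, 1), so its k-th power is scalar exactly when x³ᵏ = 1;
the scalar xᵏ then has cube 1, as required in SL(3, F). -/
theorem sigma2_sq_pow_eq_one_iff (k : ℕ) :
    ((sigmaMat2 x : PSL(3, F)) ^ 2) ^ k = 1 ↔ (x ^ 3) ^ k = 1 := by
  have hx : (x : F) ≠ 0 := x.ne_zero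
  rw [← QuotientGroup.mk_pow, ← QuotientGroup.mk_pow, ← QuotientGroup.mk_one, eq_comm, psl_eq_iff,
    sigmaMat2_sq_pow, Units.ext_iff]
  simp only [Units.val_pow_eq_pow_val, Units.val_one]
  have e1 : ((x : F)⁻¹ ^ 2) ^ k = (((x : F) ^ k) ^ 2)⁻¹ := by
    rw [inv_pow, inv_pow, ← pow_mul, ← pow_mul, mul_comm]
  have e2 : ((x : F) ^ 3) ^ k = ((x : F) ^ k) ^ 3 := by rw [← pow_mul, ← pow_mul, mul_comm]
  have hk : (x : F) ^ k ≠ 0 := pow_ne_zero k hx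
  rw [e1, e2]
  generalize (x : F) ^ k = u at hk
  constructor
  · rintro ⟨r, -, h⟩
    have h0 := congr_fun₂ h 0 0
    have h1 := congr_fun₂ h 1 1
    simp at h0 h1
    rw [← h1] at h0
    field_simp at h0
    exact h0.symm
  · intro h
    refine ⟨u, h, ?_⟩
    have : (u ^ 2)⁻¹ = u := by
      field_simp
      exact h.symm
    rw [this]
    ext i j
    fin_cases i <;> fin_cases j <;> simp

/-- Odd powers of σ₂ swap the two base points. -/
theorem even_orderOf_sigma2 {n : ℕ} (h : (sigmaMat2 x : PSL(3, F)) ^ n = 1) : Even n := by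
  by_contra hn
  obtain ⟨m, rfl⟩ := Nat.not_even_iff_odd.1 hn
  rw [pow_succ, pow_mul, ← QuotientGroup.mk_pow, ← QuotientGroup.mk_pow, ← QuotientGroup.mk_mul,
    ← QuotientGroup.mk_one, eq_comm, psl_eq_iff] at h
  obtain ⟨r, -, h⟩ := h
  have := congr_fun₂ h 1 2
  rw [Matrix.SpecialLinearGroup.coe_mul, sigmaMat2_sq_pow, coe_sigmaMat2] at this
  simp [Matrix.mul_apply, Fin.sum_univ_three] at this

theorem orderOf_sigma2 :
    orderOf (sigmaMat2 x : PSL(3, F)) = 2 * (orderOf x / Nat.gcd 3 (orderOf x)) := by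
  have h2 : orderOf ((sigmaMat2 x : PSL(3, F)) ^ 2) = orderOf (x ^ 3) :=
    orderOf_eq_orderOf_iff.2 fun n => sigma2_sq_pow_eq_one_iff x n
  obtain ⟨m, hm⟩ := even_orderOf_sigma2 x (pow_orderOf_eq_one (sigmaMat2 x : PSL(3, F)))
  rw [orderOf_pow' _ two_ne_zero, orderOf_pow' _ three_ne_zero, Nat.gcd_comm (orderOf x), 
    Nat.gcd_eq_right (by rw [hm]; exact ⟨m, by ring⟩)] at h2
  rw [← h2]
  omega

theorem mem_closure_points_iff {x : Fˣ} [Finite F] (h1 : (x : F) ^ 2 ≠ 1)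
    (hx : ∀ y : Fˣ, y ∈ Subgroup.zpowers x) (h3 : (x : F) ^ 3 ≠ 1) (A : SL(3, F)) :
    (A : PSL(3, F)) ∈ Subgroup.closure {(sigmaMat2 x : PSL(3, F)), (sigmaMat3 x : PSL(3, F))} ↔
      PermutesPoints A.1 := by
  rw [closure_sigma_points x hx h1 h3, mem_stabilizer_points_iff]

/-- C is the adjoint of A for the polarity, hence the inverse of the dual of A up to scalars; a
group contains an element together with its inverse. -/
theorem mk_mem_closure_lines_iff {x : Fˣ} [Finite F] (h1 : (x : F) ^ 2 ≠ 1)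
    (hx : ∀ y : Fˣ, y ∈ Subgroup.zpowers x) (h3 : (x : F) ^ 3 ≠ 1) (A : SL(3, F)) :
    (A : PSL(3, F)) ∈ Subgroup.closure {(sigmaMat1 x : PSL(3, F)), (sigmaMat2 x : PSL(3, F))} ↔
      ∃ C : SL(3, F), PermutesPoints C.1 ∧ A.1ᵀ * sigmaGram x = sigmaGram x * C.1 := by
  rw [mem_closure_lines_iff h1]
  constructor
  · intro h
    obtain ⟨C, hC, e⟩ := exists_sigmaDuality_mk h1 A
    rw [e, inv_mem_iff, mem_closure_points_iff h1 hx h3] at h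
    exact ⟨C, h, hC⟩
  · rintro ⟨C, h, hC⟩
    rw [sigmaDuality_mk_of_mul_eq h1 hC, inv_mem_iff, mem_closure_points_iff h1 hx h3]
    exact h

theorem sigmaGram_mul_eq {x : Fˣ} {A C : SL(3, F)}
    (h : A.1ᵀ * sigmaGram x = sigmaGram x * C.1) :
    A.1 1 0 * x - A.1 2 0 = ((x : F) - 1) ^ 2 * (x + 1) * (x : F)⁻¹ * C.1 0 1 ∧
    -A.1 1 0 + A.1 2 0 = ((x : F) - 1) ^ 2 * (x + 1) * (x : F)⁻¹ * C.1 0 2 ∧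
    A.1 1 1 * x - A.1 2 1 = x * C.1 1 1 - C.1 2 1 ∧
    -A.1 1 1 + A.1 2 1 = x * C.1 1 2 - C.1 2 2 ∧
    A.1 1 2 * x - A.1 2 2 = -C.1 1 1 + C.1 2 1 ∧
    -A.1 1 2 + A.1 2 2 = -C.1 1 2 + C.1 2 2 := by
  have e := fun i j => congr_fun₂ h i j
  have e1 := e 0 1
  have e2 := e 0 2
  have e3 := e 1 1
  have e4 := e 1 2
  have e5 := e 2 1
  have e6 := e 2 2
  simp [Matrix.mul_apply, Fin.sum_univ_three, sigmaGram] at e1 e2 e3 e4 e5 e6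
  exact ⟨by linear_combination e1, by linear_combination e2, by linear_combination e3,
    by linear_combination e4, by linear_combination e5, by linear_combination e6⟩

/-- Elements of the stabiliser of the pair of lines fix the point where these lines meet. -/
theorem entries_eq_zero_of_mem_closure_lines {x : Fˣ} [Finite F] (h1 : (x : F) ^ 2 ≠ 1)
    (hx : ∀ y : Fˣ, y ∈ Subgroup.zpowers x) (h3 : (x : F) ^ 3 ≠ 1) {A : SL(3, F)}
    (hA : (A : PSL(3, F)) ∈
      Subgroup.closure {(sigmaMat1 x : PSL(3, F)), (sigmaMat2 x : PSL(3, F))}) :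
    A.1 1 0 = 0 ∧ A.1 2 0 = 0 := by
  obtain ⟨C, ⟨c1, c2, -⟩, h⟩ := (mk_mem_closure_lines_iff h1 hx h3 A).1 hA
  obtain ⟨e1, e2, -⟩ := sigmaGram_mul_eq h
  rw [c1, mul_zero] at e1
  rw [c2, mul_zero] at e2
  -- The lower 2 × 2 block of the Gram matrix has determinant x - 1.
  have : A.1 1 0 * ((x : F) - 1) = 0 := by linear_combination e1 + e2
  have h10 := (mul_eq_zero.1 this).resolve_right (sub_one_ne_zero_of_sq h1)
  exact ⟨h10, by linear_combination e2 + h10⟩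

end SigmaFacts

/-! ### Conditions for the intersection property, and generation. -/

section Intersection

open Matrix

variable {F : Type*} [Field F] {x : Fˣ}

/-- Determinant 1 leaves only diag(u⁻², u, u); writing u = xᵏ, this is the k-th power of the square
of σ₂. -/
theorem mem_zpowers_sigma2_of_diag [Finite F]
    (hx : ∀ y : Fˣ, y ∈ Subgroup.zpowers x) {A : SL(3, F)} (h01 : A.1 0 1 = 0) (h02 : A.1 0 2 = 0)
    (h10 : A.1 1 0 = 0) (h20 : A.1 2 0 = 0) (h12 : A.1 1 2 = 0) (h21 : A.1 2 1 = 0)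
    (h : A.1 1 1 = A.1 2 2) :
    (A : PSL(3, F)) ∈ Subgroup.zpowers (sigmaMat2 x : PSL(3, F)) := by
  have hdet := A.2
  rw [Matrix.det_fin_three] at hdet
  simp only [h01, h02, h12, h21, mul_zero, zero_mul, sub_zero, add_zero] at hdet
  have hs : A.1 2 2 ≠ 0 := by intro h; simp [h] at hdet
  obtain ⟨k, hk⟩ := mem_powers_iff_mem_zpowers.2 (hx (Units.mk0 _ hs))
  have hk' : (x : F) ^ k = A.1 2 2 := by simpa using congrArg Units.val hk
  have h00 : A.1 0 0 = ((x : F)⁻¹ ^ 2) ^ k := by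
    rw [inv_pow, inv_pow, ← pow_mul, mul_comm, pow_mul, hk']
    rw [h] at hdet
    field_simp
    linear_combination hdet
  have hA : A = (sigmaMat2 x ^ 2) ^ k := by
    refine Subtype.ext ?_
    rw [sigmaMat2_sq_pow]
    ext i j
    fin_cases i <;> fin_cases j <;> simp [h01, h02, h10, h20, h12, h21, h, h00, hk']
  rw [hA, QuotientGroup.mk_pow, QuotientGroup.mk_pow]
  exact pow_mem (pow_mem (Subgroup.mem_zpowers _) 2) k

/-- The two polar lines meet the line joining the two points at (1 : x) and (1 : 1) in its
coordinates. If an element fixes both points and swaps the lines, or swaps the points and fixes both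
lines, then x² = 1. If it fixes all of them it is scalar on the joining line; if it swaps both
pairs, multiplication by σ₂ reduces to that case. -/
theorem closure_points_inf_closure_lines
    [Finite F] (h1 : (x : F) ^ 2 ≠ 1) (hx : ∀ y : Fˣ, y ∈ Subgroup.zpowers x)
    (h3 : (x : F) ^ 3 ≠ 1) :
    Subgroup.closure {(sigmaMat2 x : PSL(3, F)), (sigmaMat3 x : PSL(3, F))} ⊓
      Subgroup.closure {(sigmaMat1 x : PSL(3, F)), (sigmaMat2 x : PSL(3, F))} ≤
      Subgroup.zpowers (sigmaMat2 x : PSL(3, F)) := by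
  rintro g ⟨hg, hg'⟩
  obtain ⟨A, rfl⟩ := QuotientGroup.mk_surjective g
  have hA : PermutesPoints A.1 := (mem_closure_points_iff h1 hx h3 A).1 hg
  obtain ⟨h10, h20⟩ := entries_eq_zero_of_mem_closure_lines h1 hx h3 hg'
  obtain ⟨C, ⟨-, -, hC⟩, e⟩ := (mk_mem_closure_lines_iff h1 hx h3 A).1 hg'
  obtain ⟨-, -, e3, e4, e5, e6⟩ := sigmaGram_mul_eq e
  have hdet := A.2
  rw [Matrix.det_fin_three] at hdet
  have hsq : (x : F) ^ 2 - 1 ≠ 0 := fun h => h1 (sub_eq_zero.1 h)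
  obtain ⟨h01, h02, ⟨h12, h21⟩ | ⟨h11, h22⟩⟩ := hA
  · refine mem_zpowers_sigma2_of_diag hx h01 h02 h10 h20 h12 h21 ?_
    simp only [h12, h21, h01, h02] at hdet e3 e4 e5 e6
    rcases hC with ⟨c12, c21⟩ | ⟨c11, c22⟩
    · simp only [c12] at e4 e6
      linear_combination -e4 - e6
    · exfalso
      simp only [c11, c22] at e3 e4 e5 e6
      have hz : A.1 2 2 * ((x : F) ^ 2 - 1) = 0 := by
        linear_combination e5 + e3 + x * e4 + x ^ 2 * e6
      have h22 := (mul_eq_zero.1 hz).resolve_right hsq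
      simp [h22] at hdet
  · simp only [h11, h22, h01, h02] at hdet e3 e4 e5 e6
    rcases hC with ⟨c12, c21⟩ | ⟨c11, c22⟩
    · exfalso
      simp only [c12, c21] at e3 e4 e5 e6
      have hz : A.1 1 2 * ((x : F) ^ 2 - 1) = 0 := by
        linear_combination x * e5 + e3 + e4 + e6
      have h12 := (mul_eq_zero.1 hz).resolve_right hsq
      simp [h12] at hdet
    · simp only [c11, c22] at e3 e4 e5 e6
      have h21 : A.1 2 1 = x * A.1 1 2 := by linear_combination e4 + x * e6
      have : (sigmaMat2 x * A : SL(3, F)) ∈ Subgroup.comap (QuotientGroup.mk' _)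
          (Subgroup.zpowers (sigmaMat2 x : PSL(3, F))) := by
        refine mem_zpowers_sigma2_of_diag hx ?_ ?_ ?_ ?_ ?_ ?_ ?_ <;>
          rw [Matrix.SpecialLinearGroup.coe_mul, coe_sigmaMat2] <;>
          simp [Matrix.mul_apply, Fin.sum_univ_three, h01, h02, h10, h20, h11, h22, h21]
      have h := mul_mem (inv_mem (Subgroup.mem_zpowers (sigmaMat2 x : PSL(3, F))))
        (show (sigmaMat2 x : PSL(3, F)) * A ∈ _ from this)
      rwa [inv_mul_cancel_left] at h

/-- The line-pair stabiliser fixes the point where the lines meet, and a power of σ₃ fixes it only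
if (x + 1)x⁻¹(y - 1) = 0 for y = xᵏ. -/
theorem sigma3_zpow_eq_one_of_mem_lines
    [Finite F] (h1 : (x : F) ^ 2 ≠ 1) (hx : ∀ y : Fˣ, y ∈ Subgroup.zpowers x)
    (h3 : (x : F) ^ 3 ≠ 1) (k : ℤ) (h : (sigmaMat3 x : PSL(3, F)) ^ k ∈
      Subgroup.closure {(sigmaMat1 x : PSL(3, F)), (sigmaMat2 x : PSL(3, F))}) :
    (sigmaMat3 x : PSL(3, F)) ^ k = 1 := by
  rw [sigma3_zpow_mk] at h ⊢
  have h10 := (entries_eq_zero_of_mem_closure_lines h1 hx h3 h).1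
  rw [sigma3Pow_mk_eq_one_iff]
  rw [coe_sigma3Pow] at h10
  simp [add_one_ne_zero_of_sq h1, sub_eq_zero] at h10
  exact Units.ext (by simpa using h10)

theorem sigma1_zpow_eq_one_of_mem_points
    [Finite F] (h1 : (x : F) ^ 2 ≠ 1) (hx : ∀ y : Fˣ, y ∈ Subgroup.zpowers x)
    (h3 : (x : F) ^ 3 ≠ 1) (k : ℤ) (h : (sigmaMat1 x : PSL(3, F)) ^ k ∈
      Subgroup.closure {(sigmaMat2 x : PSL(3, F)), (sigmaMat3 x : PSL(3, F))}) :
    (sigmaMat1 x : PSL(3, F)) ^ k = 1 := by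
  rw [← sigmaDuality_sigmaDuality h1 ((sigmaMat1 x : PSL(3, F)) ^ k), ← mem_closure_lines_iff h1,
    map_zpow, sigmaDuality_sigma1, _root_.inv_zpow, inv_mem_iff] at h
  have := sigma3_zpow_eq_one_of_mem_lines h1 hx h3 k h
  rw [← (sigmaDuality x h1).map_eq_one_iff, map_zpow, sigmaDuality_sigma1, _root_.inv_zpow, this,
    inv_one]

theorem sigma12_notMem_points
    [Finite F] (h1 : (x : F) ^ 2 ≠ 1) (hx : ∀ y : Fˣ, y ∈ Subgroup.zpowers x)
    (h3 : (x : F) ^ 3 ≠ 1) :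
    (sigmaMat1 x : PSL(3, F)) * (sigmaMat2 x : PSL(3, F)) ∉
      Subgroup.closure {(sigmaMat2 x : PSL(3, F)), (sigmaMat3 x : PSL(3, F))} := by
  rw [← QuotientGroup.mk_mul, mem_closure_points_iff h1 hx h3, sigmaMat12_mul]
  simp [PermutesPoints]

theorem sigma23_notMem_lines
    [Finite F] (h1 : (x : F) ^ 2 ≠ 1) (hx : ∀ y : Fˣ, y ∈ Subgroup.zpowers x)
    (h3 : (x : F) ^ 3 ≠ 1) :
    (sigmaMat2 x : PSL(3, F)) * (sigmaMat3 x : PSL(3, F)) ∉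
      Subgroup.closure {(sigmaMat1 x : PSL(3, F)), (sigmaMat2 x : PSL(3, F))} := by
  rw [mem_closure_lines_iff h1, map_mul, sigmaDuality_sigma2, sigmaDuality_sigma3,
    ← _root_.mul_inv_rev,
    inv_mem_iff]
  exact sigma12_notMem_points h1 hx h3

/-- If equality held, the adjoint C of A = σ₃ʲσ₁σ₂σ₃ would be a scalar multiple of σ₃ᵏ. The middle
column of A, minus a basis vector, forces both last diagonal entries of C to be -1; so the scalar is
-1 and xᵏ = 1. Then A would be trivial in PSL(3, F), but its entry (0, 2) is nonzero. -/
theorem sigma1_zpow_ne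
    (h1 : (x : F) ^ 2 ≠ 1) (j k : ℤ) :
    (sigmaMat1 x : PSL(3, F)) ^ k ≠ (sigmaMat3 x : PSL(3, F)) ^ j *
      ((sigmaMat1 x : PSL(3, F)) * (sigmaMat2 x : PSL(3, F)) * (sigmaMat3 x : PSL(3, F))) := by
  intro h
  have hx0 : (x : F) ≠ 0 := x.ne_zero
  obtain ⟨A, hA⟩ : ∃ A : SL(3, F), A = sigma3Pow x (x ^ j) *
    (sigmaMat1 x * sigmaMat2 x * sigmaMat3 x) := ⟨_, rfl⟩
  have hmk : (A : PSL(3, F)) = (sigmaMat1 x : PSL(3, F)) ^ k := by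
    rw [h, hA, sigma3_zpow_mk]
    rfl
  have c01 : A.1 0 1 = 0 := by
    rw [hA, Matrix.SpecialLinearGroup.coe_mul, sigmaMat123_mul, coe_sigma3Pow]
    simp [Matrix.mul_apply, Fin.sum_univ_three]
  have c11 : A.1 1 1 = -1 := by
    rw [hA, Matrix.SpecialLinearGroup.coe_mul, sigmaMat123_mul, coe_sigma3Pow]
    simp [Matrix.mul_apply, Fin.sum_univ_three]
  have c21 : A.1 2 1 = 0 := by
    rw [hA, Matrix.SpecialLinearGroup.coe_mul, sigmaMat123_mul, coe_sigma3Pow]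
    simp [Matrix.mul_apply, Fin.sum_univ_three]
  have c02 : A.1 0 2 ≠ 0 := by
    rw [hA, Matrix.SpecialLinearGroup.coe_mul, sigmaMat123_mul, coe_sigma3Pow]
    simp [Matrix.mul_apply, Fin.sum_univ_three]
    exact zpow_ne_zero j hx0
  obtain ⟨C, hC, hdual⟩ := exists_sigmaDuality_mk h1 A
  rw [hmk, map_zpow, sigmaDuality_sigma1, _root_.inv_zpow, _root_.inv_inj, sigma3_zpow_mk, eq_comm,
    psl_eq_iff] at hdual
  obtain ⟨r, -, hr⟩ := hdual
  obtain ⟨-, -, e3, e4, -, -⟩ := sigmaGram_mul_eq hC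
  have r11 := congr_fun₂ hr 1 1
  have r12 := congr_fun₂ hr 1 2
  have r21 := congr_fun₂ hr 2 1
  have r22 := congr_fun₂ hr 2 2
  rw [coe_sigma3Pow] at r11 r12 r21 r22
  simp only [Matrix.smul_apply, smul_eq_mul] at r11 r12 r21 r22
  simp at r11 r12 r21 r22
  have hr0 : r ≠ 0 := by rintro rfl; simp at r11
  rw [c11, c21, r21.resolve_left hr0] at e3
  rw [c11, c21, r12.resolve_left hr0] at e4
  have ec : C.1 1 1 = -1 := mul_left_cancel₀ hx0 (by linear_combination -e3)
  have hr1 : r = -1 := by rw [ec] at r11; linear_combination r11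
  have ec' : C.1 2 2 = -1 := by linear_combination e4
  rw [ec', hr1] at r22
  have hk : x ^ k = 1 := by
    refine Units.ext ?_
    have : ((x : F) ^ k)⁻¹ = 1 := by simpa using r22
    simpa using this
  have : (A : PSL(3, F)) = 1 := by
    rw [hmk, ← (sigmaDuality x h1).map_eq_one_iff, map_zpow, sigmaDuality_sigma1, _root_.inv_zpow,
      sigma3_zpow_mk, hk, map_one, QuotientGroup.mk_one, inv_one]
  rw [← QuotientGroup.mk_one, eq_comm, psl_eq_iff] at this
  obtain ⟨s, -, hs⟩ := this
  apply c02
  rw [hs]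
  simp

/-- The point stabiliser contains the diagonal matrices and the transvections in positions (1, 0)
and (2, 0). The line stabiliser contains those in positions (0, 1) and (0, 2), and commutators
supply the other two. -/
theorem closure_sigma_eq_top
    [Finite F] (h1 : (x : F) ^ 2 ≠ 1) (hx : ∀ y : Fˣ, y ∈ Subgroup.zpowers x)
    (h3 : (x : F) ^ 3 ≠ 1) :
    Subgroup.closure {(sigmaMat1 x : PSL(3, F)), (sigmaMat2 x : PSL(3, F)),
      (sigmaMat3 x : PSL(3, F))} = ⊤ := by
  have hx0 : (x : F) ≠ 0 := x.ne_zero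
  have hxm := sub_one_ne_zero_of_sq h1
  have hxp := add_one_ne_zero_of_sq h1
  set H := Subgroup.closure {(sigmaMat1 x : PSL(3, F)), (sigmaMat2 x : PSL(3, F)),
      (sigmaMat3 x : PSL(3, F))} with hH
  have hpts : ∀ A : SL(3, F), PermutesPoints A.1 → (A : PSL(3, F)) ∈ H := fun A hA =>
    Subgroup.closure_mono (by intro g hg; simp at hg ⊢; tauto)
      ((mem_closure_points_iff h1 hx h3 A).2 hA)
  have hlines : ∀ A C : SL(3, F), PermutesPoints C.1 → A.1ᵀ * sigmaGram x = sigmaGram x * C.1 →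
      (A : PSL(3, F)) ∈ H := fun A C hC hA =>
    Subgroup.closure_mono (by intro g hg; simp at hg ⊢; tauto)
      ((mk_mem_closure_lines_iff h1 hx h3 A).2 ⟨C, hC, hA⟩)
  have hel : ∀ p r, PermutesPoints (elation p r : SL(3, F)).1 := fun p r => by
    simp [PermutesPoints, coe_elation]
  let E {i j : Fin 3} (hij : i ≠ j) (a : F) : SL(3, F) :=
    Matrix.SpecialLinearGroup.transvection hij a
  have h10 : ∀ a, (E (show (1 : Fin 3) ≠ 0 by decide) a : PSL(3, F)) ∈ H := fun a => hpts _ (by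
    simp [E, PermutesPoints, Matrix.SpecialLinearGroup.transvection_coe])
  have h20 : ∀ a, (E (show (2 : Fin 3) ≠ 0 by decide) a : PSL(3, F)) ∈ H := fun a => hpts _ (by
    simp [E, PermutesPoints, Matrix.SpecialLinearGroup.transvection_coe])
  have h01 : ∀ a, (E (show (0 : Fin 3) ≠ 1 by decide) a : PSL(3, F)) ∈ H := fun a => by
    -- The adjoint of this transvection is an elation; its entries solve the 2 × 2 system of the
    -- lower Gram block, which cancels one factor x - 1 of the corner entry.
    refine hlines _ (elation (a * ((x - 1) * (x + 1) * (x : F)⁻¹))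
      (a * ((x - 1) * (x + 1) * (x : F)⁻¹))) (hel _ _) ?_
    rw [coe_elation, sigmaGram, Matrix.SpecialLinearGroup.transvection_coe]
    ext i j
    fin_cases i <;> fin_cases j <;>
      simp [Matrix.mul_apply, Fin.sum_univ_three, Matrix.single_apply] <;> ring
  have h02 : ∀ a, (E (show (0 : Fin 3) ≠ 2 by decide) a : PSL(3, F)) ∈ H := fun a => by
    refine hlines _ (elation (a * ((x - 1) * (x + 1) * (x : F)⁻¹)) (a * ((x - 1) * (x + 1))))
      (hel _ _) ?_
    rw [coe_elation, sigmaGram, Matrix.SpecialLinearGroup.transvection_coe]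
    ext i j
    fin_cases i <;> fin_cases j <;>
      simp [Matrix.mul_apply, Fin.sum_univ_three, Matrix.single_apply] <;> field_simp <;> ring
  have h12 : ∀ a, (E (show (1 : Fin 3) ≠ 2 by decide) a : PSL(3, F)) ∈ H := fun a => by
    have : E (show (1 : Fin 3) ≠ 2 by decide) a =
        E (show (1 : Fin 3) ≠ 0 by decide) a * E (show (0 : Fin 3) ≠ 2 by decide) 1 *
        (E (show (1 : Fin 3) ≠ 0 by decide) a)⁻¹ * (E (show (0 : Fin 3) ≠ 2 by decide) 1)⁻¹ := by
      rw [eq_mul_inv_iff_mul_eq, eq_mul_inv_iff_mul_eq]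
      refine Subtype.ext ?_
      simp only [E, Matrix.SpecialLinearGroup.coe_mul, Matrix.SpecialLinearGroup.transvection_coe]
      ext i j
      fin_cases i <;> fin_cases j <;>
        simp [Matrix.mul_apply, Fin.sum_univ_three, Matrix.single_apply]
    rw [this]
    exact mul_mem (mul_mem (mul_mem (h10 a) (h02 1)) (inv_mem (h10 a))) (inv_mem (h02 1))
  have h21 : ∀ a, (E (show (2 : Fin 3) ≠ 1 by decide) a : PSL(3, F)) ∈ H := fun a => by
    have : E (show (2 : Fin 3) ≠ 1 by decide) a =
        E (show (2 : Fin 3) ≠ 0 by decide) a * E (show (0 : Fin 3) ≠ 1 by decide) 1 *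
        (E (show (2 : Fin 3) ≠ 0 by decide) a)⁻¹ * (E (show (0 : Fin 3) ≠ 1 by decide) 1)⁻¹ := by
      rw [eq_mul_inv_iff_mul_eq, eq_mul_inv_iff_mul_eq]
      refine Subtype.ext ?_
      simp only [E, Matrix.SpecialLinearGroup.coe_mul, Matrix.SpecialLinearGroup.transvection_coe]
      ext i j
      fin_cases i <;> fin_cases j <;>
        simp [Matrix.mul_apply, Fin.sum_univ_three, Matrix.single_apply]
    rw [this]
    exact mul_mem (mul_mem (mul_mem (h20 a) (h01 1)) (inv_mem (h20 a))) (inv_mem (h01 1))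
  rw [eq_top_iff]
  intro g _
  obtain ⟨A, rfl⟩ := QuotientGroup.mk_surjective g
  refine Matrix.SpecialLinearGroup.diagonal_transvection_induction'
    (fun A : SL(3, F) => (A : PSL(3, F)) ∈ H) A ?_ ?_ ?_
  · intro i j hij c hc
    refine hpts _ ?_
    rw [PermutesPoints, Matrix.SpecialLinearGroup.diag2n_coe]
    simp
  · intro i j hij a
    fin_cases i <;> fin_cases j <;> first
      | exact absurd rfl hij
      | exact h01 a
      | exact h02 a
      | exact h10 a
      | exact h12 a
      | exact h20 a
      | exact h21 a
  · intro A B hA hB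
    exact mul_mem hA hB

end Intersection

/-! ### Assembly of the theorem. -/

section CPlus

variable {F : Type*} [Field F] {x : Fˣ}

theorem orderOf_sigma1 (h1 : (x : F) ^ 2 ≠ 1) : orderOf (sigmaMat1 x : PSL(3, F)) = orderOf x := by
  rw [← orderOf_sigma3 x, ← MulEquiv.orderOf_eq (sigmaDuality x h1), sigmaDuality_sigma1,
    orderOf_inv]

theorem orderOf_sigma23 (h1 : (x : F) ^ 2 ≠ 1) :
    orderOf ((sigmaMat2 x : PSL(3, F)) * (sigmaMat3 x : PSL(3, F))) = 2 := by
  rw [← orderOf_sigma12 x, ← MulEquiv.orderOf_eq (sigmaDuality x h1) (_ * _), map_mul,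
    sigmaDuality_sigma2, sigmaDuality_sigma3, ← mul_inv_rev, orderOf_inv]

theorem not_exists_automorphism [Finite F] (h1 : (x : F) ^ 2 ≠ 1)
    (hx : ∀ y : Fˣ, y ∈ Subgroup.zpowers x) (h3 : (x : F) ^ 3 ≠ 1) (φ : PSL(3, F) ≃* PSL(3, F))
    (hφ1 : φ (sigmaMat1 x : PSL(3, F)) = (sigmaMat1 x : PSL(3, F))⁻¹)
    (hφ2 : φ ((sigmaMat1 x : PSL(3, F)) * (sigmaMat2 x : PSL(3, F))) =
      (sigmaMat1 x : PSL(3, F)) * (sigmaMat2 x : PSL(3, F)))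
    (hφ3 : φ ((sigmaMat1 x : PSL(3, F)) * (sigmaMat2 x : PSL(3, F)) * (sigmaMat3 x : PSL(3, F))) =
      (sigmaMat1 x : PSL(3, F)) * (sigmaMat2 x : PSL(3, F)) * (sigmaMat3 x : PSL(3, F))) :
    False := by
  have ht := pow_orderOf_eq_one ((sigmaMat1 x : PSL(3, F)) * (sigmaMat2 x : PSL(3, F)))
  have hu := pow_orderOf_eq_one
    ((sigmaMat1 x : PSL(3, F)) * (sigmaMat2 x : PSL(3, F)) * (sigmaMat3 x : PSL(3, F)))
  rw [orderOf_sigma12] at ht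
  rw [orderOf_sigma123] at hu
  have h2 := (map_mul φ _ _).symm.trans hφ2
  rw [map_mul, hφ2, mul_right_inj] at hφ3
  rw [hφ1, inv_mul_eq_iff_eq_mul] at h2
  -- With t = σ₁σ₂, the map φ fixes σ₃ and sends σ₂ to σ₁t. Conjugating by t turns these into tσ₃t =
  -- σ₃⁻¹ and tσ₁ = σ₂⁻¹, because t and tσ₃ are involutions.
  refine not_exists_invert x hx h1 h3 (φ.trans (MulAut.conj
    ((sigmaMat1 x : PSL(3, F)) * (sigmaMat2 x : PSL(3, F))))) ?_ ?_
  · rw [MulEquiv.trans_apply, h2, MulAut.conj_apply]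
    refine eq_inv_of_mul_eq_one_left ?_
    rw [← ht, sq]
    group
  · rw [MulEquiv.trans_apply, hφ3, MulAut.conj_apply,
      inv_eq_of_mul_eq_one_left ((sq _).symm.trans ht)]
    exact eq_inv_of_mul_eq_one_left (by simpa only [sq, mul_assoc] using hu)

theorem isCPlusGroup_sigma [Finite F] (h1 : (x : F) ^ 2 ≠ 1)
    (hx : ∀ y : Fˣ, y ∈ Subgroup.zpowers x) (h3 : (x : F) ^ 3 ≠ 1) : IsCPlusGroup (sigma x) := by
  obtain ⟨-, -, -, h02, h13, h03⟩ := rotProd_rank_four (sigmaMat1 x : PSL(3, F))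
    (sigmaMat2 x : PSL(3, F)) (sigmaMat3 x : PSL(3, F))
  have hx2 : x ^ 2 ≠ 1 := fun h => h1 (by simpa using congrArg Units.val h)
  refine ⟨?_, ?_, intersection_rank_four _ _ _ (orderOf_sigma12 x) (orderOf_sigma23 h1)
    (orderOf_sigma123 x) ?_ ?_ (sigma1_zpow_eq_one_of_mem_points h1 hx h3)
    (sigma3_zpow_eq_one_of_mem_lines h1 hx h3) (sigma12_notMem_points h1 hx h3)
    (sigma23_notMem_lines h1 hx h3) (closure_points_inf_closure_lines h1 hx h3)
    (sigma1_zpow_ne h1), ?_⟩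
  · rw [← closure_sigma_eq_top h1 hx h3, sigma]
    congr 1
    ext g
    simp
    tauto
  · intro i j hij
    fin_cases i <;> fin_cases j <;> simp at hij
    · exact (congrArg orderOf h02).trans (orderOf_sigma12 x)
    · exact (congrArg orderOf h03).trans (orderOf_sigma123 x)
    · exact (congrArg orderOf h13).trans (orderOf_sigma23 h1)
  · rwa [← sq, ne_eq, ← orderOf_dvd_iff_pow_eq_one, orderOf_sigma1 h1, orderOf_dvd_iff_pow_eq_one]
  · rwa [← sq, ne_eq, ← orderOf_dvd_iff_pow_eq_one, orderOf_sigma3, orderOf_dvd_iff_pow_eq_one]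
  · rintro ⟨φ, hφ1, hφ⟩
    have e2 := hφ 2 le_rfl
    have e3 := hφ 3 (by decide)
    rw [sigma, h02] at e2
    rw [sigma, h03] at e3
    exact not_exists_automorphism h1 hx h3 φ hφ1 e2 e3

theorem span_single_injective {n : Type*} [DecidableEq n] {i j : n}
    (h : Submodule.span F {(Pi.single i 1 : n → F)} = Submodule.span F {Pi.single j 1}) :
    i = j := by
  have : (Pi.single i 1 : n → F) ∈ Submodule.span F {(Pi.single j 1 : n → F)} :=
    h ▸ Submodule.mem_span_singleton_self _
  obtain ⟨r, hr⟩ := Submodule.mem_span_singleton.1 this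
  by_contra hij
  have := congr_fun hr i
  simp [hij] at this

end CPlus

theorem theorem1p1 {F : Type*} [Field F] [Fintype F] (hq : 5 ≤ Fintype.card F)
    (x : Fˣ) (hx : ∀ y : Fˣ, y ∈ Subgroup.zpowers x) :
    IsCPlusGroup (sigma x) ∧
    (∃ l l' : Submodule F (Fin 3 → F),
      Module.finrank F l = 2 ∧ Module.finrank F l' = 2 ∧ l ≠ l' ∧
      Subgroup.closure {sigma x 0, sigma x 1} =
        MulAction.stabilizer PSL(3, F) ({l, l'} : Set (Submodule F (Fin 3 → F)))) ∧
    (∃ p p' : Submodule F (Fin 3 → F),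
      Module.finrank F p = 1 ∧ Module.finrank F p' = 1 ∧ p ≠ p' ∧
      Subgroup.closure {sigma x 1, sigma x 2} =
        MulAction.stabilizer PSL(3, F) ({p, p'} : Set (Submodule F (Fin 3 → F)))) ∧
    IsSelfDual (sigma x) ∧
    schlafliType (sigma x) =
      ![Fintype.card F - 1,
        2 * (Fintype.card F - 1) / Nat.gcd 3 (Fintype.card F - 1),
        Fintype.card F - 1] := by
  have hord : orderOf x = Fintype.card F - 1 := by
    classical
    rw [orderOf_eq_card_of_forall_mem_zpowers hx, Nat.card_eq_fintype_card, Fintype.card_units]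
  -- The bound q ≥ 5 is used only here: x has order q - 1 ≥ 4.
  have hpow : ∀ k, k ≠ 0 → k < 4 → (x : F) ^ k ≠ 1 := fun k hk hk4 h =>
    pow_ne_one_of_lt_orderOf hk (by omega : k < orderOf x) (Units.ext (by simpa using h))
  have h1 := hpow 2 (by decide) (by decide)
  have h3 := hpow 3 (by decide) (by decide)
  have hne : Submodule.span F {(Pi.single 1 1 : Fin 3 → F)} ≠ Submodule.span F {Pi.single 2 1} :=
    fun h => absurd (span_single_injective h) (by decide)
  have hrank : ∀ i, Module.finrank F (Submodule.span F {(Pi.single i 1 : Fin 3 → F)}) = 1 :=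
    fun i => finrank_span_singleton (by simp)
  have hnd := nondegenerate_sigmaGram h1
  have hrefl := (Matrix.isSymm_toBilin'_iff_isSymm.2 (sigmaGram_transpose x)).isRefl
  have hrank' : ∀ i, Module.finrank F ((Matrix.toBilin' (sigmaGram x)).orthogonal
      (Submodule.span F {(Pi.single i 1 : Fin 3 → F)})) = 2 := fun i => by
    rw [LinearMap.BilinForm.finrank_orthogonal hnd, hrank]
    simp
  refine ⟨isCPlusGroup_sigma h1 hx h3, ⟨_, _, hrank' 1, hrank' 2, fun h => hne ?_,
    closure_sigma_lines h1 hx h3⟩, ⟨_, _, hrank 1, hrank 2, hne, closure_sigma_points x hx h1 h3⟩,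
    ⟨sigmaDuality x h1, fun i => ?_⟩, funext fun i => ?_⟩
  · rw [← LinearMap.BilinForm.orthogonal_orthogonal hnd hrefl (Submodule.span F {Pi.single 1 1}),
      h, LinearMap.BilinForm.orthogonal_orthogonal hnd hrefl]
  · fin_cases i
    · exact sigmaDuality_sigma1 h1
    · exact sigmaDuality_sigma2 h1
    · exact sigmaDuality_sigma3 h1
  · fin_cases i
    · exact (orderOf_sigma1 h1).trans hord
    · refine (orderOf_sigma2 x).trans ?_
      rw [hord, ← Nat.mul_div_assoc _ (Nat.gcd_dvd_right _ _)]
      rfl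
    · exact (orderOf_sigma3 x).trans hord
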